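/- Let $\Lambda$ be a constraint satisfaction problem, that is, a finite collection of predicates $P:[q]^{k}\to\{0,1\}$ over an alphabet $[q]$ (the arity $k=\mathrm{ar}(P)$ may depend on $P$). An unweighted instance of $\Lambda$ consists of variables $x_1,\dots,x_n$ and constraints $C_1,\dots,C_m$, $m\ge 1$ (repetitions allowed), where $C_r=(P_r,S_r)$ with $P_r\in\Lambda$ and $S_r$ an ordered tuple of $\mathrm{ar}(P_r)$ distinct variables. It is regular if all variables have the same degree, the degree of a variable being the number of constraints in whose scope $S_r$ it occurs. A weighted instance carries in addition rational weights $w_r\ge 0$ with $\sum_r w_r=1$, written in binary; an unweighted instance is given the weights $w_r=1/m$. For an assignment $\chi$ of values in $[q]$ to the variables of an instance $\mathcal F$ put $\mathrm{Val}_\chi(\mathcal F)=\sum_r w_r P_r(\chi(S_r))$, and let $\mathrm{Opt}(\mathcal F)=\min_\chi \mathrm{Val}_\chi(\mathcal F)$. An $\alpha$-approximation algorithm for Min-CSP $\Lambda$ on a class of instances is a deterministic polynomial-time algorithm that finds, for every instance $\mathcal F$ of the class, an assignment $\chi$ with $\mathrm{Val}_\chi(\mathcal F)\le \alpha\cdot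 \mathrm{Opt}(\mathcal F)$. Theorem. Let $\alpha\ge 1$ be a real number. If there is an $\alpha$-approximation algorithm for Min-CSP $\Lambda$ on unweighted regular instances, then for every $\delta>0$ there is an $(\alpha+\delta)$-approximation algorithm for Min-CSP $\Lambda$ on all weighted instances. -/

import Mathlib

open scoped BigOperators

namespace RegCSP

/-! ### A model of computation with a step count

Data are binary trees whose leaves carry natural numbers in binary; programs are built from
elementary operations by composition, pairing, branching and unbounded `while` loops.
Every elementary operation is charged the bit length of everything that it reads and writes
(logarithmic cost), so neither large numbers nor shared subtrees come for free, and polynomial time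
in this model is polynomial time on deterministic Turing machines. -/

/-- Binary trees with natural numbers at the leaves. -/
inductive Data : Type where
  | num : ℕ → Data
  | pair : Data → Data → Data

namespace Data

/-- The bit length of a tree (`Nat.size k` is the number of binary digits of `k`). -/
def size : Data → ℕ
  | num k => Nat.size k + 1
  | pair a b => a.size + b.size + 1

/-- The outcome of a test: everything except the number `0` counts as true. -/
def isTrue : Data → Bool
  | num 0 => false
  | _ => true

/-- A list of trees as a tree: `[a, b, c]` is `(a, (b, (c, 0)))`. -/
def ofList : List Data → Data
  | [] => num 0
  | a :: l => pair a (ofList l)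

end Data

/-- The elementary operations. -/
inductive Prim : Type where
  | id
  | const (k : ℕ)
  | fst
  | snd
  | isPair
  | add
  | sub
  | mul
  | div

/-- The meaning of the elementary operations. An operation that is applied to data of the wrong
shape returns `0`; subtraction is truncated, division is rounded down (and `a / 0 = 0`). -/
def Prim.apply : Prim → Data → Data
  | .id, x => x
  | .const k, _ => .num k
  | .fst, .pair a _ => a
  | .snd, .pair _ b => b
  | .isPair, .pair _ _ => .num 1
  | .add, .pair (.num a) (.num b) => .num (a + b)
  | .sub, .pair (.num a) (.num b) => .num (a - b)
  | .mul, .pair (.num a) (.num b) => .num (a * b)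
  | .div, .pair (.num a) (.num b) => .num (a / b)
  | _, _ => .num 0

/-- Programs. `comp g f` is "first `f`, then `g`"; `pair f g` runs `f` and `g` on the same input and
pairs the results; `cond c f g` is "if `c` then `f` else `g`"; `loop c f` is "while `c` do `f`". -/
inductive Code : Type where
  | prim (p : Prim)
  | comp (g f : Code)
  | pair (f g : Code)
  | cond (c f g : Code)
  | loop (c f : Code)

/-- `Runs c x y t`: the program `c`, started on `x`, halts with the result `y` after time `t`. -/
inductive Code.Runs : Code → Data → Data → ℕ → Prop where
  | prim (p : Prim) (x : Data) :
      Runs (.prim p) x (p.apply x) (x.size + (p.apply x).size)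
  | comp {f g : Code} {x y z : Data} {s t : ℕ} :
      Runs f x y s → Runs g y z t → Runs (.comp g f) x z (s + t + 1)
  | pair {f g : Code} {x y z : Data} {s t : ℕ} :
      Runs f x y s → Runs g x z t → Runs (.pair f g) x (.pair y z) (s + t + 1)
  | cond_true {c f g : Code} {x b y : Data} {s t : ℕ} :
      Runs c x b s → b.isTrue = true → Runs f x y t → Runs (.cond c f g) x y (s + t + 1)
  | cond_false {c f g : Code} {x b y : Data} {s t : ℕ} :
      Runs c x b s → b.isTrue = false → Runs g x y t → Runs (.cond c f g) x y (s + t + 1)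
  | loop_done {c f : Code} {x b : Data} {s : ℕ} :
      Runs c x b s → b.isTrue = false → Runs (.loop c f) x x (s + 1)
  | loop_step {c f : Code} {x b y z : Data} {s t u : ℕ} :
      Runs c x b s → b.isTrue = true → Runs f x y t → Runs (.loop c f) y z u →
        Runs (.loop c f) x z (s + t + u + 1)

/-- The model is deterministic: result and running time are determined by the input. -/
theorem Code.Runs.deterministic {c : Code} {x y : Data} {t : ℕ} (h : c.Runs x y t) :
    ∀ {y' : Data} {t' : ℕ}, c.Runs x y' t' → y' = y ∧ t' = t := by
  induction h with
  | prim p x => intro y' t' h'; cases h'; exact ⟨rfl, rfl⟩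
  | comp _ _ ih₁ ih₂ =>
    intro y' t' h'
    cases h' with
    | comp a b =>
      obtain ⟨rfl, rfl⟩ := ih₁ a
      obtain ⟨rfl, rfl⟩ := ih₂ b
      exact ⟨rfl, rfl⟩
  | pair _ _ ih₁ ih₂ =>
    intro y' t' h'
    cases h' with
    | pair a b =>
      obtain ⟨rfl, rfl⟩ := ih₁ a
      obtain ⟨rfl, rfl⟩ := ih₂ b
      exact ⟨rfl, rfl⟩
  | cond_true _ hb _ ih₁ ih₂ =>
    intro y' t' h'
    cases h' with
    | cond_true a _ b =>
      obtain ⟨rfl, rfl⟩ := ih₁ a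
      obtain ⟨rfl, rfl⟩ := ih₂ b
      exact ⟨rfl, rfl⟩
    | cond_false a hb' b =>
      obtain ⟨rfl, rfl⟩ := ih₁ a
      simp [hb] at hb'
  | cond_false _ hb _ ih₁ ih₂ =>
    intro y' t' h'
    cases h' with
    | cond_true a hb' b =>
      obtain ⟨rfl, rfl⟩ := ih₁ a
      simp [hb] at hb'
    | cond_false a _ b =>
      obtain ⟨rfl, rfl⟩ := ih₁ a
      obtain ⟨rfl, rfl⟩ := ih₂ b
      exact ⟨rfl, rfl⟩
  | loop_done _ hb ih₁ =>
    intro y' t' h'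
    cases h' with
    | loop_done a _ =>
      obtain ⟨rfl, rfl⟩ := ih₁ a
      exact ⟨rfl, rfl⟩
    | loop_step a hb' _ _ =>
      obtain ⟨rfl, rfl⟩ := ih₁ a
      simp [hb] at hb'
  | loop_step _ hb _ _ ih₁ ih₂ ih₃ =>
    intro y' t' h'
    cases h' with
    | loop_done a hb' =>
      obtain ⟨rfl, rfl⟩ := ih₁ a
      simp [hb] at hb'
    | loop_step a _ b d =>
      obtain ⟨rfl, rfl⟩ := ih₁ a
      obtain ⟨rfl, rfl⟩ := ih₂ b
      obtain ⟨rfl, rfl⟩ := ih₃ d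
      exact ⟨rfl, rfl⟩

/-- The running time bounds the bit length of the input and of the result: in particular no
program can build exponentially large data in polynomial time. -/
theorem Code.Runs.size_le {c : Code} {x y : Data} {t : ℕ} (h : c.Runs x y t) :
    x.size ≤ t ∧ y.size ≤ t := by
  induction h with
  | pair _ _ ih₁ ih₂ => simp only [Data.size]; omega
  | _ => omega

/-- A search problem with inputs `i : I`, with candidate solutions `o : O i`, and with `good i o`
saying which solutions are acceptable, is solved by a deterministic polynomial-time algorithm:
one program and one polynomial work for all inputs. -/
def SolvableInPolyTime {I : Type} {O : I → Type} (encIn : I → Data)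
    (encOut : ∀ i, O i → Data) (good : ∀ i, O i → Prop) : Prop :=
  ∃ (c : Code) (p : Polynomial ℕ), ∀ i : I, ∃ (o : O i) (t : ℕ),
    c.Runs (encIn i) (encOut i o) t ∧ t ≤ p.eval (encIn i).size ∧ good i o

/-! ### Constraint satisfaction problems -/

/-- A predicate `[q] ^ k → {0, 1}` of some arity `k`. -/
structure Predicate (q : ℕ) where
  arity : ℕ
  holds : (Fin arity → Fin q) → Bool

/-- A constraint satisfaction problem: a finite collection of predicates over the alphabet `[q]`. -/
structure CSP where
  q : ℕ
  numPred : ℕ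
  pred : Fin numPred → Predicate q

/-- A constraint on `n` variables: a predicate of the problem together with its scope, an ordered
tuple of distinct variables whose length is the arity of the predicate. -/
structure Constraint (Λ : CSP) (n : ℕ) where
  idx : Fin Λ.numPred
  scope : Fin (Λ.pred idx).arity ↪ Fin n

/-- The value `P (χ (S)) ∈ {0, 1}` of the constraint `(P, S)` under the assignment `χ`. -/
def Constraint.eval {Λ : CSP} {n : ℕ} (C : Constraint Λ n) (χ : Fin n → Fin Λ.q) : ℚ≥0 :=
  if (Λ.pred C.idx).holds (fun j => χ (C.scope j)) = true then 1 else 0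

/-- An (unweighted) instance: `n` variables and `m` constraints; constraints may be repeated. -/
structure Instance (Λ : CSP) where
  n : ℕ
  m : ℕ
  constr : Fin m → Constraint Λ n

/-- A weighted instance: every constraint carries a nonnegative (rational) weight, and the weights
sum to `1`. -/
structure WeightedInstance (Λ : CSP) extends Instance Λ where
  weight : Fin m → ℚ≥0
  weight_sum : ∑ r, weight r = 1

/-- Assignments of values to the variables. -/
abbrev Instance.Assignment {Λ : CSP} (F : Instance Λ) : Type := Fin F.n → Fin Λ.q

/-- The number of constraints in whose scope the variable `i` occurs. -/
noncomputable def Instance.degree {Λ : CSP} (F : Instance Λ) (i : Fin F.n) : ℕ :=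
  Nat.card {r : Fin F.m // ∃ j, (F.constr r).scope j = i}

/-- All variables have the same degree. -/
def Instance.Regular {Λ : CSP} (F : Instance Λ) : Prop :=
  ∃ D : ℕ, ∀ i : Fin F.n, F.degree i = D

/-- An unweighted instance with at least one constraint, seen as a weighted instance in which each
of the `m` constraints has the weight `1 / m`. -/
def Instance.uniform {Λ : CSP} (F : Instance Λ) (hm : 0 < F.m) : WeightedInstance Λ where
  toInstance := F
  weight := fun _ => 1 / (F.m : ℚ≥0)
  weight_sum := by
    have h : (F.m : ℚ≥0) ≠ 0 := by exact_mod_cast hm.ne'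
    simp [h]

/-- `Val_χ(F)`, the total weight of the satisfied constraints. -/
def WeightedInstance.val {Λ : CSP} (F : WeightedInstance Λ) (χ : F.Assignment) : ℚ≥0 :=
  ∑ r, F.weight r * (F.constr r).eval χ

/-- `Opt(F)` for the minimization problem: the minimum of `Val_χ(F)` over all assignments `χ`
(there are finitely many assignments, so the infimum is attained). -/
noncomputable def WeightedInstance.opt {Λ : CSP} (F : WeightedInstance Λ) : ℝ :=
  ⨅ χ : F.Assignment, (F.val χ : ℝ)

/-! ### Encodings -/

/-- The list of the variables `0, …, n - 1`; its size is at least `n`. -/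
def encodeVars (n : ℕ) : Data :=
  Data.ofList (List.ofFn fun i : Fin n => Data.num i)

/-- A constraint is written as the index of its predicate and the list of the variables in its
scope. -/
def Constraint.encode {Λ : CSP} {n : ℕ} (C : Constraint Λ n) : Data :=
  .pair (.num C.idx) (Data.ofList (List.ofFn fun j => Data.num (C.scope j)))

/-- A nonnegative rational is written as numerator and denominator, in binary and in lowest
terms. -/
def encodeWeight (w : ℚ≥0) : Data :=
  .pair (.num w.num) (.num w.den)

/-- An unweighted instance is written as the list of its variables and the list of its
constraints. -/
def Instance.encode {Λ : CSP} (F : Instance Λ) : Data :=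
  .pair (encodeVars F.n) (Data.ofList (List.ofFn fun r => (F.constr r).encode))

/-- A weighted instance is written as the list of its variables and the list of its constraints
with their weights. -/
def WeightedInstance.encode {Λ : CSP} (F : WeightedInstance Λ) : Data :=
  .pair (encodeVars F.n)
    (Data.ofList (List.ofFn fun r => .pair (F.constr r).encode (encodeWeight (F.weight r))))

/-- An assignment is written as the list of its values. -/
def Instance.encodeAssignment {Λ : CSP} (F : Instance Λ) (χ : F.Assignment) : Data :=
  Data.ofList (List.ofFn fun i => Data.num (χ i))

/-! ### Approximation algorithms -/

/-- Weighted Min-CSP `Λ` has a polynomial-time `α`-approximation algorithm: it finds, for every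
weighted instance `F`, an assignment `χ` with `Val_χ(F) ≤ α * Opt(F)`. -/
def HasWeightedMinApprox (Λ : CSP) (α : ℝ) : Prop :=
  SolvableInPolyTime (I := WeightedInstance Λ) (O := fun F => F.Assignment)
    (fun F => F.encode) (fun F χ => F.encodeAssignment χ)
    (fun F χ => (F.val χ : ℝ) ≤ α * F.opt)

/-- Unweighted regular instances of Min-CSP `Λ` have a polynomial-time `α`-approximation
algorithm; nothing is required of the algorithm on other inputs. -/
def HasRegularMinApprox (Λ : CSP) (α : ℝ) : Prop :=
  SolvableInPolyTime (I := {F : Instance Λ // F.Regular ∧ 0 < F.m}) (O := fun F => F.1.Assignment)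
    (fun F => F.1.encode) (fun F χ => F.1.encodeAssignment χ)
    (fun F χ => ((F.1.uniform F.2.2).val χ : ℝ) ≤ α * (F.1.uniform F.2.2).opt)

end RegCSP

namespace RegCSP

/-! ### Polynomially bounded functions -/

/-! Two reductions lead from weighted to regular instances, and each loses only a factor that tends
to 1 as an integer parameter `K` grows.

From weights to multiplicities: clearing denominators gives integral weights `u` that are short in
binary but possibly exponentially large. Let `w` be the largest weight of a constraint satisfied by
an optimal assignment; there are at most `m` candidates for `w`, so all can be tried. Repeat a
constraint of weight `u` about `u * K * m / w` times, rounded up, but at most `B * m ^ 2` times. For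
the right guess and a nonzero optimum, rounding up adds at most `m` to a scaled optimum of at least
`K * m`, a factor `(K + 1) / K`. The cap does no harm: the scaled optimum is at most `(K + 1) * m ^
2`, so for `B > α * K * (K + 1)` an approximate solution cannot afford a capped constraint. See
`exists_guess` and `sum_le_of_sum_multiplicity_le`.

From multiplicities to regularity: a variable with `d` occurrences gets `d` copies, and the whole
list of, say, `W` constraints is run through in `M = K * W` rounds. During full periods of `d`
rounds, every occurrence in round `t` uses copy `t % d`; in the fewer than `d` remaining rounds each
occurrence uses a copy of its own. Hence every copy has degree `M` (`sum_copy_eq`). In each of the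
first `M - W` rounds the constraints see a single assignment of the original variables, so the best
of these assignments is at most the average, and only `K / (K - 1)` is lost
(`exists_satCount_roundAssignment_le`).

Altogether the factor is `α * (K + 1) / (K - 1)`, at most `α + δ` for large `K`. The algorithm tries
all guesses and all rounds and keeps the cheapest assignment. Its running time is derived from
closure properties of `PolyTime` rather than from an explicit program; what needs care is that lists
stay short and loop counters stay polynomial in value. -/

theorem polynomial_eval_mono (p : Polynomial ℕ) : Monotone fun n => p.eval n := by
  intro m n h
  simp only [Polynomial.eval_eq_sum]
  exact Finset.sum_le_sum fun i _ => Nat.mul_le_mul_left _ (Nat.pow_le_pow_left h i)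

/-- `f` is bounded by a polynomial in the size of `a`. -/
def PolyBdd {ι : Type} (a : ι → Data) (f : ι → ℕ) : Prop :=
  ∃ p : Polynomial ℕ, ∀ i, f i ≤ p.eval (a i).size

namespace PolyBdd

variable {ι κ : Type} {a b : ι → Data} {f g : ι → ℕ}

theorem mono (hg : PolyBdd a g) (h : ∀ i, f i ≤ g i) : PolyBdd a f :=
  let ⟨p, hp⟩ := hg
  ⟨p, fun i => (h i).trans (hp i)⟩

theorem const (k : ℕ) : PolyBdd a fun _ => k := ⟨Polynomial.C k, fun i => by simp⟩

theorem size : PolyBdd a fun i => (a i).size := ⟨Polynomial.X, fun i => by simp⟩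

theorem add (hf : PolyBdd a f) (hg : PolyBdd a g) : PolyBdd a fun i => f i + g i :=
  let ⟨p, hp⟩ := hf
  let ⟨q, hq⟩ := hg
  ⟨p + q, fun i => by simpa using Nat.add_le_add (hp i) (hq i)⟩

theorem mul (hf : PolyBdd a f) (hg : PolyBdd a g) : PolyBdd a fun i => f i * g i :=
  let ⟨p, hp⟩ := hf
  let ⟨q, hq⟩ := hg
  ⟨p * q, fun i => by simpa using Nat.mul_le_mul (hp i) (hq i)⟩

theorem comp (hf : PolyBdd b f) (hb : PolyBdd a fun i => (b i).size) : PolyBdd a f :=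
  let ⟨p, hp⟩ := hf
  let ⟨q, hq⟩ := hb
  ⟨p.comp q, fun i => by
    rw [Polynomial.eval_comp]
    exact (hp i).trans (polynomial_eval_mono p (hq i))⟩

theorem eval (p : Polynomial ℕ) (hf : PolyBdd a f) : PolyBdd a fun i => p.eval (f i) :=
  let ⟨q, hq⟩ := hf
  ⟨p.comp q, fun i => by
    rw [Polynomial.eval_comp]
    exact polynomial_eval_mono p (hq i)⟩

theorem reindex (hf : PolyBdd a f) (e : κ → ι) : PolyBdd (fun k => a (e k)) fun k => f (e k) :=
  let ⟨p, hp⟩ := hf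
  ⟨p, fun k => hp (e k)⟩

end PolyBdd

/-! ### Polynomial-time computable families -/

theorem nat_size_mul_le (m n : ℕ) : Nat.size (m * n) ≤ Nat.size m + Nat.size n := by
  rw [Nat.size_le, pow_add]
  exact Nat.mul_lt_mul'' (Nat.lt_size_self m) (Nat.lt_size_self n)

theorem nat_size_add_le (m n : ℕ) : Nat.size (m + n) ≤ Nat.size m + Nat.size n := by
  rw [Nat.size_le, pow_add]
  have h₁ := Nat.lt_size_self m
  have h₂ := Nat.lt_size_self n
  nlinarith

theorem nat_size_le_self (n : ℕ) : Nat.size n ≤ n := by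
  rw [Nat.size_le]
  exact Nat.lt_two_pow_self

/-- One program computes all `b i` from `a i` in time polynomial in the size of `a i`. -/
def PolyTime {ι : Type} (a b : ι → Data) : Prop :=
  ∃ (c : Code) (t : ι → ℕ), (∀ i, c.Runs (a i) (b i) (t i)) ∧ PolyBdd a t

namespace PolyTime

variable {ι κ : Type} {a b d : ι → Data}

theorem polyBdd_size (h : PolyTime a b) : PolyBdd a fun i => (b i).size :=
  let ⟨_, _, hr, ht⟩ := h
  ht.mono fun i => (hr i).size_le.2

/-- Nothing is demanded outside the listed inputs, so a program for a family serves all of its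
subfamilies. This is how the solver, specified on regular instances only, is applied to the
instances that the reduction produces. -/
theorem reindex (h : PolyTime a b) (e : κ → ι) : PolyTime (fun k => a (e k)) fun k => b (e k) :=
  let ⟨c, t, hr, ht⟩ := h
  ⟨c, fun k => t (e k), fun k => hr (e k), ht.reindex e⟩

theorem comp (h₂ : PolyTime b d) (h₁ : PolyTime a b) : PolyTime a d :=
  let ⟨c₂, t₂, hr₂, ht₂⟩ := h₂
  let ⟨c₁, t₁, hr₁, ht₁⟩ := h₁
  ⟨.comp c₂ c₁, fun i => t₁ i + t₂ i + 1, fun i => .comp (hr₁ i) (hr₂ i),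
    (ht₁.add (ht₂.comp h₁.polyBdd_size)).add (.const 1)⟩

theorem pair (h₁ : PolyTime a b) (h₂ : PolyTime a d) : PolyTime a fun i => .pair (b i) (d i) :=
  let ⟨c₁, t₁, hr₁, ht₁⟩ := h₁
  let ⟨c₂, t₂, hr₂, ht₂⟩ := h₂
  ⟨.pair c₁ c₂, fun i => t₁ i + t₂ i + 1, fun i => .pair (hr₁ i) (hr₂ i),
    (ht₁.add ht₂).add (.const 1)⟩

theorem ofPrim (p : Prim) (hp : PolyBdd a fun i => (p.apply (a i)).size) :
    PolyTime a fun i => p.apply (a i) :=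
  ⟨.prim p, _, fun i => .prim p (a i), PolyBdd.size.add hp⟩

theorem id : PolyTime a a := ofPrim .id .size

theorem num (k : ℕ) : PolyTime a fun _ => .num k := ofPrim (.const k) (.const _)

theorem fst : PolyTime a fun i => Prim.fst.apply (a i) :=
  ofPrim .fst <| PolyBdd.size.mono fun i => by
    rcases a i with k | ⟨x, y⟩ <;> simp [Prim.apply, Data.size]; omega

theorem snd : PolyTime a fun i => Prim.snd.apply (a i) :=
  ofPrim .snd <| PolyBdd.size.mono fun i => by
    rcases a i with k | ⟨x, y⟩ <;> simp [Prim.apply, Data.size]; omega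

theorem isPair : PolyTime a fun i => Prim.isPair.apply (a i) :=
  ofPrim .isPair <| (PolyBdd.const 2).mono fun i => by
    rcases a i with k | ⟨x, y⟩ <;> simp [Prim.apply, Data.size]

theorem fst_pair (h : PolyTime a fun i => .pair (b i) (d i)) : PolyTime a b :=
  fst.comp h

theorem snd_pair (h : PolyTime a fun i => .pair (b i) (d i)) : PolyTime a d :=
  snd.comp h

variable {f g : ι → ℕ}

theorem arith (p : Prim) (op : ℕ → ℕ → ℕ)
    (hp : ∀ m n, p.apply (.pair (.num m) (.num n)) = .num (op m n))
    (hs : ∀ m n, Nat.size (op m n) ≤ Nat.size m + Nat.size n)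
    (hf : PolyTime a fun i => .num (f i)) (hg : PolyTime a fun i => .num (g i)) :
    PolyTime a fun i => .num (op (f i) (g i)) := by
  have := (ofPrim p (a := fun i => Data.pair (.num (f i)) (.num (g i)))
    (PolyBdd.size.mono fun i => by
      have := hs (f i) (g i)
      simp only [hp, Data.size]; omega)).comp (hf.pair hg)
  simpa only [hp] using this

theorem test_cond {t : ι → Data} (ht : PolyTime a t) (hb : PolyTime a b) (hd : PolyTime a d) :
    PolyTime a fun i => if (t i).isTrue = true then b i else d i := by
  obtain ⟨c, s, hr, hs⟩ := ht
  obtain ⟨c₁, t₁, hr₁, ht₁⟩ := hb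
  obtain ⟨c₂, t₂, hr₂, ht₂⟩ := hd
  refine ⟨.cond c c₁ c₂, fun i => s i + (if (t i).isTrue = true then t₁ i else t₂ i) + 1,
    fun i => ?_, ((hs.add (ht₁.add ht₂)).add (.const 1)).mono fun i => ?_⟩
  · cases h : (t i).isTrue
    · simpa [h] using Code.Runs.cond_false (hr i) h (hr₂ i)
    · simpa [h] using Code.Runs.cond_true (hr i) h (hr₁ i)
  · split_ifs <;> omega

/-- A loop is a polynomial-time program if the number of its rounds and all its intermediate
states are polynomially bounded. -/
theorem loop {N : ι → ℕ} {st : ι → ℕ → Data} {t : ι → ℕ → Data}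
    (ht : PolyTime (fun z : {z : ι × ℕ // z.2 ≤ N z.1} => st z.1.1 z.1.2) fun z => t z.1.1 z.1.2)
    (htest : ∀ i k, k ≤ N i → ((t i k).isTrue = true ↔ k < N i))
    (hf : PolyTime (fun z : {z : ι × ℕ // z.2 < N z.1} => st z.1.1 z.1.2)
      fun z => st z.1.1 (z.1.2 + 1))
    (hN : PolyBdd (fun i => st i 0) N)
    (hB : ∃ B : ι → ℕ, PolyBdd (fun i => st i 0) B ∧ ∀ i k, k ≤ N i → (st i k).size ≤ B i) :
    PolyTime (fun i => st i 0) fun i => st i (N i) := by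
  obtain ⟨c, s, hr, p, hs⟩ := ht
  obtain ⟨c', s', hr', p', hs'⟩ := hf
  obtain ⟨B, hB, hsize⟩ := hB
  -- Induction on the number `j` of rounds still to go, since `Code.Runs.loop_step` puts one round
  -- in front of the remaining run. Every round starts from a state of size at most `B i`, whence
  -- the uniform cost per round.
  have key : ∀ i j, j ≤ N i → ∃ u ≤ (j + 1) * (p.eval (B i) + p'.eval (B i) + 2),
      (Code.loop c c').Runs (st i (N i - j)) (st i (N i)) u := by
    intro i j
    induction j with
    | zero =>
      intro _
      have hp := (hs ⟨(i, N i), le_rfl⟩).trans (polynomial_eval_mono p (hsize i (N i) le_rfl))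
      refine ⟨s ⟨(i, N i), le_rfl⟩ + 1, by dsimp only at hp ⊢; omega, ?_⟩
      refine .loop_done (hr ⟨(i, N i), le_rfl⟩) ?_
      have := htest i (N i) le_rfl
      simpa using this
    | succ j ih =>
      intro hj
      obtain ⟨u, hu, hru⟩ := ih (by omega)
      have hlt : N i - (j + 1) < N i := by omega
      have hp := (hs ⟨(i, N i - (j + 1)), hlt.le⟩).trans
        (polynomial_eval_mono p (hsize i _ hlt.le))
      have hp' := (hs' ⟨(i, N i - (j + 1)), hlt⟩).trans
        (polynomial_eval_mono p' (hsize i _ hlt.le))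
      refine ⟨s ⟨(i, N i - (j + 1)), hlt.le⟩ + s' ⟨(i, N i - (j + 1)), hlt⟩ + u + 1, ?_,
        .loop_step (hr ⟨(i, N i - (j + 1)), hlt.le⟩) ((htest i _ hlt.le).2 hlt)
          (hr' ⟨(i, N i - (j + 1)), hlt⟩) ?_⟩
      · rw [add_mul (j + 1), one_mul]
        dsimp only at hp hp'
        omega
      · have : N i - (j + 1) + 1 = N i - j := by omega
        simpa only [this] using hru
  choose u hu hru using fun i => key i (N i) le_rfl
  refine ⟨.loop c c', u, fun i => by simpa using hru i, ?_⟩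
  exact ((hN.add (.const 1)).mul (((hB.eval p).add (hB.eval p')).add (.const 2))).mono hu

end PolyTime

/-! ### Encodable types -/

/-- Types whose elements are written as trees. -/
class Enc (α : Type) where
  enc : α → Data

open Enc (enc)

instance : Enc Data := ⟨fun x => x⟩
instance : Enc ℕ := ⟨.num⟩
instance {α β : Type} [Enc α] [Enc β] : Enc (α × β) := ⟨fun x => .pair (enc x.1) (enc x.2)⟩
instance {α : Type} [Enc α] : Enc (List α) := ⟨fun l => .ofList (l.map enc)⟩

variable {α β σ ι κ : Type} [Enc α] [Enc β] [Enc σ]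

theorem enc_nat (n : ℕ) : enc n = .num n := rfl
theorem enc_prod (x : α) (y : β) : enc (x, y) = .pair (enc x) (enc y) := rfl
theorem enc_nil : enc ([] : List α) = .num 0 := rfl
theorem enc_cons (x : α) (l : List α) : enc (x :: l) = .pair (enc x) (enc l) := rfl

theorem size_enc_list (l : List α) :
    (enc l).size = (l.map fun x => (enc x).size + 1).sum + 1 := by
  induction l with
  | nil => simp [enc_nil, Data.size]
  | cons x l ih => simp only [enc_cons, Data.size, ih, List.map_cons, List.sum_cons]; omega

theorem length_lt_size_enc (l : List α) : l.length < (enc l).size := by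
  induction l with
  | nil => simp [enc_nil, Data.size]
  | cons x l ih => simp only [enc_cons, Data.size, List.length_cons]; omega

theorem size_enc_lt_of_mem {l : List α} {x : α} (h : x ∈ l) : (enc x).size < (enc l).size := by
  induction l with
  | nil => simp at h
  | cons y l ih =>
    simp only [enc_cons, Data.size]
    rcases List.mem_cons.1 h with rfl | h
    · omega
    · have := ih h; omega

theorem size_enc_le_of_sublist {l l' : List α} (h : l.Sublist l') :
    (enc l).size ≤ (enc l').size := by
  induction h with
  | slnil => exact le_rfl
  | cons x _ ih => simp only [enc_cons, Data.size]; omega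
  | cons_cons x _ ih => simp only [enc_cons, Data.size]; omega

theorem size_enc_list_le (l : List α) (B : ℕ) (h : ∀ x ∈ l, (enc x).size ≤ B) :
    (enc l).size ≤ l.length * (B + 1) + 1 := by
  rw [size_enc_list]
  have := List.sum_le_card_nsmul (l.map fun x => (enc x).size + 1) (B + 1) (by
    intro y hy
    obtain ⟨x, hx, rfl⟩ := List.mem_map.1 hy
    exact Nat.succ_le_succ (h x hx))
  simpa using this

/-! ### Polynomial-time functions with values in encodable types -/

/-- All the `f i` are computed from `a i` by one program in polynomial time. -/
def PolyFun (a : ι → Data) (f : ι → α) : Prop := PolyTime a fun i => enc (f i)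

/-- All the statements `P i` are decided from `a i` by one program in polynomial time. -/
def PolyDec (a : ι → Data) (P : ι → Prop) : Prop :=
  ∃ t : ι → Data, PolyTime a t ∧ ∀ i, (t i).isTrue = true ↔ P i

/-- The environment inside of an iteration over the elements of a list. -/
def ext (a : ι → Data) (l : ι → List α) : {z : ι × α // z.2 ∈ l z.1} → Data :=
  fun z => .pair (a z.1.1) (enc z.1.2)

theorem PolyBdd.lift {a : ι → Data} {f : ι → ℕ} (h : PolyBdd a f) (l : ι → List α) :
    PolyBdd (ext a l) fun z => f z.1.1 :=
  PolyBdd.comp (b := fun z : {z : ι × α // z.2 ∈ l z.1} => a z.1.1)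
    (h.reindex fun z : {z : ι × α // z.2 ∈ l z.1} => z.1.1)
    (PolyBdd.size.mono fun z => by simp only [ext, Data.size]; omega)

namespace PolyFun

variable {a : ι → Data}

theorem comp {b : ι → Data} {f : ι → α} (hf : PolyFun b f) (hb : PolyTime a b) : PolyFun a f :=
  PolyTime.comp hf hb

theorem polyBdd_size {f : ι → α} (h : PolyFun a f) : PolyBdd a fun i => (enc (f i)).size :=
  PolyTime.polyBdd_size h

theorem polyBdd_length {l : ι → List α} (h : PolyFun a l) : PolyBdd a fun i => (l i).length :=
  h.polyBdd_size.mono fun i => (length_lt_size_enc (l i)).le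

theorem reindex {f : ι → α} (h : PolyFun a f) (e : κ → ι) :
    PolyFun (fun k => a (e k)) fun k => f (e k) :=
  PolyTime.reindex h e

theorem lift {f : ι → β} (h : PolyFun a f) (l : ι → List α) :
    PolyFun (ext a l) fun z => f z.1.1 :=
  (h.reindex fun z : {z : ι × α // z.2 ∈ l z.1} => z.1.1).comp PolyTime.fst

theorem var (l : ι → List α) : PolyFun (ext a l) fun z => z.1.2 :=
  PolyTime.snd (a := ext a l)

theorem prod {f : ι → α} {g : ι → β} (hf : PolyFun a f) (hg : PolyFun a g) :
    PolyFun a fun i => (f i, g i) :=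
  PolyTime.pair hf hg

theorem fst {f : ι → α × β} (hf : PolyFun a f) : PolyFun a fun i => (f i).1 :=
  PolyTime.fst.comp hf

theorem snd {f : ι → α × β} (hf : PolyFun a f) : PolyFun a fun i => (f i).2 :=
  PolyTime.snd.comp hf

theorem cons {f : ι → α} {l : ι → List α} (hf : PolyFun a f) (hl : PolyFun a l) :
    PolyFun a fun i => f i :: l i :=
  PolyTime.pair hf hl

theorem nil : PolyFun a fun _ => ([] : List α) := PolyTime.num 0

theorem nat (k : ℕ) : PolyFun a fun _ => k := PolyTime.num k

theorem constData (x : Data) : PolyFun a fun _ => x := by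
  induction x with
  | num k => exact nat k
  | pair x y hx hy => exact PolyTime.pair hx hy

theorem const (x : α) : PolyFun a fun _ => x := constData (enc x)

variable {f g : ι → ℕ}

theorem add (hf : PolyFun a f) (hg : PolyFun a g) : PolyFun a fun i => f i + g i :=
  PolyTime.arith .add (· + ·) (fun _ _ => rfl) nat_size_add_le hf hg

theorem sub (hf : PolyFun a f) (hg : PolyFun a g) : PolyFun a fun i => f i - g i :=
  PolyTime.arith .sub (· - ·) (fun _ _ => rfl)
    (fun m n => (Nat.size_le_size (Nat.sub_le m n)).trans (Nat.le_add_right _ _)) hf hg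

theorem mul (hf : PolyFun a f) (hg : PolyFun a g) : PolyFun a fun i => f i * g i :=
  PolyTime.arith .mul (· * ·) (fun _ _ => rfl) nat_size_mul_le hf hg

theorem div (hf : PolyFun a f) (hg : PolyFun a g) : PolyFun a fun i => f i / g i :=
  PolyTime.arith .div (· / ·) (fun _ _ => rfl)
    (fun m n => (Nat.size_le_size (Nat.div_le_self m n)).trans (Nat.le_add_right _ _)) hf hg

theorem mod (hf : PolyFun a f) (hg : PolyFun a g) : PolyFun a fun i => f i % g i := by
  simpa only [Nat.mod_eq_sub_mul_div] using hf.sub (hg.mul (hf.div hg))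

theorem ite {P : ι → Prop} [DecidablePred P] {f g : ι → α} (hP : PolyDec a P)
    (hf : PolyFun a f) (hg : PolyFun a g) : PolyFun a fun i => if P i then f i else g i := by
  obtain ⟨t, ht, hP⟩ := hP
  have := PolyTime.test_cond ht hf hg
  unfold PolyFun
  convert this using 2 with i
  by_cases h : P i
  · simp only [if_pos h, if_pos ((hP i).2 h)]
  · simp only [if_neg h, if_neg (mt (hP i).1 h)]

end PolyFun

theorem Data.isTrue_num (k : ℕ) : (Data.num k).isTrue = true ↔ k ≠ 0 := by
  cases k <;> simp [Data.isTrue]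

namespace PolyDec

variable {a : ι → Data} {f g : ι → ℕ} {P Q : ι → Prop}

theorem congr (hP : PolyDec a P) (h : ∀ i, P i ↔ Q i) : PolyDec a Q :=
  let ⟨t, ht, hP⟩ := hP
  ⟨t, ht, fun i => (hP i).trans (h i)⟩

theorem of_ne_zero (hf : PolyFun a f) : PolyDec a fun i => f i ≠ 0 :=
  ⟨_, hf, fun i => Data.isTrue_num (f i)⟩

/-- A test may return arbitrary data; replacing it by a number turns the logical connectives into
arithmetic. -/
theorem exists_indicator (hP : PolyDec a P) :
    ∃ f : ι → ℕ, PolyFun a f ∧ ∀ i, f i ≠ 0 ↔ P i := by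
  classical
  exact ⟨fun i => if P i then 1 else 0, .ite hP (.nat 1) (.nat 0), fun i => by simp⟩

theorem not (hP : PolyDec a P) : PolyDec a fun i => ¬ P i := by
  obtain ⟨f, hf, h⟩ := hP.exists_indicator
  exact (of_ne_zero ((PolyFun.nat 1).sub hf)).congr fun i => by
    rw [← h i]; omega

theorem and (hP : PolyDec a P) (hQ : PolyDec a Q) : PolyDec a fun i => P i ∧ Q i := by
  obtain ⟨f, hf, h⟩ := hP.exists_indicator
  obtain ⟨g, hg, h'⟩ := hQ.exists_indicator
  exact (of_ne_zero (hf.mul hg)).congr fun i => by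
    rw [← h i, ← h' i, ← mul_ne_zero_iff]

theorem or (hP : PolyDec a P) (hQ : PolyDec a Q) : PolyDec a fun i => P i ∨ Q i :=
  (hP.not.and hQ.not).not.congr fun i => by tauto

theorem lt (hf : PolyFun a f) (hg : PolyFun a g) : PolyDec a fun i => f i < g i :=
  (of_ne_zero (hg.sub hf)).congr fun i => by omega

theorem eq (hf : PolyFun a f) (hg : PolyFun a g) : PolyDec a fun i => f i = g i :=
  ((lt hf hg).not.and (lt hg hf).not).congr fun i => by omega

theorem isPair {x : ι → Data} (hx : PolyTime a x) : PolyDec a fun i => ∃ y z, x i = .pair y z :=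
  ⟨_, PolyTime.isPair.comp hx, fun i => by
    change (Prim.isPair.apply (x i)).isTrue = true ↔ ∃ y z, x i = .pair y z
    generalize x i = w
    rcases w with k | ⟨y, z⟩ <;> simp [Prim.apply, Data.isTrue]⟩

theorem eq_data (y : Data) {a : ι → Data} {x : ι → Data} (hx : PolyTime a x) :
    PolyDec a fun i => x i = y := by
  induction y generalizing ι with
  | num k =>
    -- Adding `0` extracts a number from arbitrary data, because `add` returns `0` on a pair.
    have hsub : PolyTime a fun i => .num (match x i with | .num m => m | .pair _ _ => 0) := by
      have h := PolyTime.ofPrim .add (a := fun i => Data.pair (x i) (.num 0))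
        (PolyBdd.size.mono fun i => by
          rcases x i with m | ⟨y, z⟩ <;> simp [Prim.apply, Data.size])
      have h := h.comp (hx.pair (.num 0))
      convert h using 2 with i
      rcases x i with m | ⟨y, z⟩ <;> simp [Prim.apply]
    refine ((isPair hx).not.and (eq hsub (.nat k))).congr fun i => ?_
    rcases x i with m | ⟨y, z⟩ <;> simp
  | pair u v hu hv =>
    refine (((isPair hx).and (hu (PolyTime.fst.comp hx))).and
      (hv (PolyTime.snd.comp hx))).congr fun i => ?_
    rcases x i with m | ⟨y, z⟩ <;> simp [Prim.apply]

/-- The list is fixed, so the test is a finite disjunction built into the program. With the table of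
satisfying tuples of `Λ` this evaluates arbitrary predicates. -/
theorem mem_list (T : List Data) {x : ι → Data} (hx : PolyTime a x) :
    PolyDec a fun i => x i ∈ T := by
  induction T with
  | nil => exact (of_ne_zero (.nat 0)).congr fun i => by simp
  | cons y T ih => exact ((eq_data y hx).or ih).congr fun i => by simp

end PolyDec

/-! ### Polynomial-time operations on lists -/

/-- The environment inside of an iteration over a list with an accumulator. -/
def extAcc (σ : Type) [Enc σ] (a : ι → Data) (l : ι → List α) :
    {z : ι × σ × α // z.2.2 ∈ l z.1} → Data :=
  fun z => .pair (.pair (a z.1.1) (enc z.1.2.1)) (enc z.1.2.2)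

namespace PolyFun

variable {a : ι → Data}

theorem acc (σ : Type) [Enc σ] (l : ι → List α) :
    PolyFun (extAcc σ a l) fun z => z.1.2.1 :=
  PolyTime.fst_pair (PolyTime.id (a := extAcc σ a l)) |>.snd_pair

theorem elem (σ : Type) [Enc σ] (l : ι → List α) :
    PolyFun (extAcc σ a l) fun z => z.1.2.2 :=
  PolyTime.snd_pair (PolyTime.id (a := extAcc σ a l))

theorem enc_drop (l : List α) (k : ℕ) (h : k < l.length) :
    enc (l.drop k) = .pair (enc l[k]) (enc (l.drop (k + 1))) := by
  rw [List.drop_eq_getElem_cons h, enc_cons]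

/-- Iterating over a list, provided that the accumulator stays polynomially bounded. -/
theorem foldl {l : ι → List α} {s : ι → σ} {f : ι → σ → α → σ}
    (hl : PolyFun a l) (hs : PolyFun a s)
    (hf : PolyFun (extAcc σ a l) fun z => f z.1.1 z.1.2.1 z.1.2.2)
    (hB : ∃ B : ι → ℕ, PolyBdd a B ∧
      ∀ i (l' : List α), l'.Sublist (l i) → (enc (l'.foldl (f i) (s i))).size ≤ B i) :
    PolyFun a fun i => (l i).foldl (f i) (s i) := by
  obtain ⟨B, hB, hsize⟩ := hB
  let acc : ι → ℕ → σ := fun i k => ((l i).take k).foldl (f i) (s i)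
  let st : ι → ℕ → Data := fun i k => .pair (.pair (a i) (enc (acc i k))) (enc ((l i).drop k))
  have hinit : PolyTime a fun i => st i 0 := by
    simpa [st, acc] using PolyTime.pair (PolyTime.pair PolyTime.id hs) hl
  have hback : PolyBdd (fun i => st i 0) fun i => (a i).size :=
    PolyBdd.size.mono fun i => by simp only [st, Data.size]; omega
  have hloop : PolyTime (fun i => st i 0) fun i => st i (l i).length := by
    -- The code of a list is a pair exactly when the list is nonempty, so `isPair` is the loop test.
    refine PolyTime.loop (t := fun i k => Prim.isPair.apply (enc ((l i).drop k)))
      ?_ ?_ ?_ (hl.polyBdd_length.comp hback) ?_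
    · exact PolyTime.isPair.comp PolyTime.snd
    · intro i k hk
      rcases hk.eq_or_lt with rfl | hk
      · simp [enc_nil, Prim.apply, Data.isTrue]
      · simp [enc_drop _ _ hk, Prim.apply, Data.isTrue, hk]
    · set a' : {z : ι × ℕ // z.2 < (l z.1).length} → Data := fun z => st z.1.1 z.1.2
      have hst : PolyTime a' fun z =>
          .pair (.pair (a z.1.1) (enc (acc z.1.1 z.1.2)))
            (.pair (enc (l z.1.1)[z.1.2]) (enc ((l z.1.1).drop (z.1.2 + 1)))) := by
        convert PolyTime.id (a := a') using 2 with z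
        simp only [a', st, enc_drop _ _ z.2]
      have hbody := hf.reindex fun z : {z : ι × ℕ // z.2 < (l z.1).length} =>
        ⟨(z.1.1, acc z.1.1 z.1.2, (l z.1.1)[z.1.2]), List.getElem_mem _⟩
      have hnew := hbody.comp (hst.fst_pair.pair hst.snd_pair.fst_pair)
      have := (hst.fst_pair.fst_pair.pair hnew).pair hst.snd_pair.snd_pair
      convert this using 4 with z
      simp only [acc, List.take_add_one, List.getElem?_eq_getElem z.2, Option.toList_some,
        List.foldl_append, List.foldl_cons, List.foldl_nil]
    · refine ⟨fun i => (a i).size + B i + (enc (l i)).size + 2,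
        (((hback.add (hB.comp hback)).add (hl.polyBdd_size.comp hback)).add (.const 2)), ?_⟩
      intro i k _
      have h₁ := hsize i _ (List.take_sublist k (l i))
      have h₂ := size_enc_le_of_sublist (List.drop_sublist k (l i))
      simp only [st, acc, Data.size]
      omega
  have := (hloop.comp hinit).fst_pair.snd_pair
  simpa [st, acc, PolyFun] using this

theorem reverse {l : ι → List α} (hl : PolyFun a l) : PolyFun a fun i => (l i).reverse := by
  have h := foldl (f := fun _ (s : List α) x => x :: s) hl nil
    ((elem _ l).cons (acc _ l)) ⟨_, hl.polyBdd_size, fun i l' h => by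
      have h := size_enc_le_of_sublist h
      have h' : (enc l'.reverse).size = (enc l').size := by
        simp [size_enc_list, List.sum_reverse]
      simpa [h'] using h⟩
  simpa using h

theorem map {l : ι → List α} {f : ι → α → β} (hl : PolyFun a l)
    (hf : PolyFun (ext a l) fun z => f z.1.1 z.1.2) : PolyFun a fun i => (l i).map (f i) := by
  have hfold : ∀ (g : α → β) (l : List α) (s : List β),
      l.foldl (fun s x => g x :: s) s = (l.map g).reverse ++ s := by
    intro g l
    induction l with
    | nil => simp
    | cons x l ih => intro s; simp [ih]
  obtain ⟨p, hp⟩ := hf.polyBdd_size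
  have h := foldl (f := fun i (s : List β) x => f i x :: s) hl nil
    (cons
      ((hf.reindex fun z : {z : ι × List β × α // z.2.2 ∈ l z.1} => ⟨(z.1.1, z.1.2.2), z.2⟩).comp
        ((PolyTime.id (a := extAcc (List β) a l)).fst_pair.fst_pair.pair (elem _ l)))
      (acc _ l))
    ⟨_, (hl.polyBdd_length.mul (((PolyBdd.size.add hl.polyBdd_size).add (.const 1)).eval p |>.add
      (.const 1))).add (.const 1), fun i l' h => by
      rw [hfold, List.append_nil]
      have h' := size_enc_list_le (l'.map (f i)).reverse
        (p.eval ((a i).size + (enc (l i)).size + 1)) fun y hy => by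
          obtain ⟨x, hx, rfl⟩ := List.mem_map.1 (List.mem_reverse.1 hy)
          refine (hp ⟨(i, x), h.subset hx⟩).trans (polynomial_eval_mono p ?_)
          have := size_enc_lt_of_mem (h.subset hx)
          simp only [ext, Data.size]
          omega
      rw [List.length_reverse, List.length_map] at h'
      exact h'.trans (Nat.succ_le_succ (Nat.mul_le_mul_right _ h.length_le))⟩
  simpa [hfold] using h.reverse

theorem append {l l' : ι → List α} (hl : PolyFun a l) (hl' : PolyFun a l') :
    PolyFun a fun i => l i ++ l' i := by
  have h := foldl (f := fun _ (s : List α) x => x :: s) hl.reverse hl'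
    ((elem _ _).cons (acc _ _))
    ⟨_, hl.polyBdd_size.add hl'.polyBdd_size, fun i k h => by
      have h := size_enc_le_of_sublist h
      have hfold : k.foldl (fun s x => x :: s) (l' i) = k.reverse ++ l' i := by simp
      rw [hfold]
      simp only [size_enc_list, List.map_append, List.sum_append, List.map_reverse,
        List.sum_reverse] at h ⊢
      omega⟩
  simpa using h

theorem size_enc_flatten (l : List (List α)) : (enc l.flatten).size ≤ (enc l).size := by
  induction l with
  | nil => exact le_rfl
  | cons x l ih =>
    simp only [size_enc_list, List.flatten_cons, List.map_append, List.sum_append, List.map_cons,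
      List.sum_cons] at ih ⊢
    omega

theorem flatten {l : ι → List (List α)} (hl : PolyFun a l) :
    PolyFun a fun i => (l i).flatten := by
  have hfold : ∀ (l : List (List α)),
      l.foldl (fun s x => x ++ s) [] = l.reverse.flatten := by
    intro l
    induction l using List.reverseRecOn with
    | nil => rfl
    | append_singleton l x ih => simp [ih]
  have h := foldl (f := fun _ (s : List α) x => x ++ s) hl.reverse nil
    ((elem _ _).append (acc _ _))
    ⟨_, hl.polyBdd_size, fun i k h => by
      rw [hfold]
      refine (size_enc_flatten _).trans (size_enc_le_of_sublist ?_)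
      simpa using h.reverse⟩
  simpa [hfold] using h

theorem flatMap {l : ι → List α} {f : ι → α → List β} (hl : PolyFun a l)
    (hf : PolyFun (ext a l) fun z => f z.1.1 z.1.2) : PolyFun a fun i => (l i).flatMap (f i) := by
  simpa only [List.flatMap_def] using (hl.map hf).flatten

/-- Counting down lets each round put the next smaller number in front, and the counter is its own
loop test. The value of `n`, not only its bit length, must be polynomial. -/
theorem range {n : ι → ℕ} (hn : PolyFun a n) (hb : PolyBdd a n) :
    PolyFun a fun i => List.range (n i) := by
  let st : ι → ℕ → Data := fun i k =>
    .pair (a i) (.pair (.num (n i - k)) (enc (List.range' (n i - k) k)))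
  have hinit : PolyTime a fun i => st i 0 := PolyTime.id.pair (hn.pair (.num 0))
  have hsize : PolyBdd (fun i => st i 0) fun i => (a i).size :=
    PolyBdd.size.mono fun i => by simp only [st, Data.size]; omega
  have hback : PolyBdd (fun i => st i 0) n := hb.comp hsize
  have hloop : PolyTime (fun i => st i 0) fun i => st i (n i) := by
    refine PolyTime.loop (t := fun i k => .num (n i - k)) ?_ ?_ ?_ hback ?_
    · exact PolyTime.fst.comp PolyTime.snd
    · intro i k hk
      rw [Data.isTrue_num]
      omega
    · set a' : {z : ι × ℕ // z.2 < n z.1} → Data := fun z => st z.1.1 z.1.2 with ha'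
      have hid : PolyTime a' fun z => st z.1.1 z.1.2 := PolyTime.id
      have hsub : PolyFun a' fun z => n z.1.1 - z.1.2 := hid.snd_pair.fst_pair
      have hm : PolyFun a' fun z => n z.1.1 - z.1.2 - 1 := hsub.sub (nat 1)
      have hr : PolyFun a' fun z => List.range' (n z.1.1 - z.1.2) z.1.2 := hid.snd_pair.snd_pair
      have := hid.fst_pair.pair (hm.pair (hm.cons hr))
      convert this using 2 with z
      have hz := z.2
      have h₁ : n z.1.1 - (z.1.2 + 1) = n z.1.1 - z.1.2 - 1 := by omega
      have h₂ : n z.1.1 - z.1.2 - 1 + 1 = n z.1.1 - z.1.2 := by omega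
      simp only [st, h₁, List.range'_succ, h₂, enc_nat]
    · refine ⟨fun i => (a i).size + (n i + 1) + (n i * (n i + 1 + 1) + 1) + 2,
        ((hsize.add (hback.add (.const 1))).add
        ((hback.mul ((hback.add (.const 1)).add (.const 1))).add (.const 1))).add (.const 2), ?_⟩
      intro i k hk
      have h₁ := nat_size_le_self (n i - k)
      have h₂ := size_enc_list_le (List.range' (n i - k) k) (n i + 1) fun x hx => by
        have := nat_size_le_self x
        rw [List.mem_range'_1] at hx
        simp only [enc_nat, Data.size]
        omega
      have h₃ : k * (n i + 1 + 1) ≤ n i * (n i + 1 + 1) := Nat.mul_le_mul_right _ hk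
      simp only [List.length_range'] at h₂
      simp only [st, Data.size]
      omega
  have := (hloop.comp hinit).snd_pair.snd_pair
  simpa [st, List.range_eq_range', PolyFun] using this

theorem sum {l : ι → List ℕ} (hl : PolyFun a l) : PolyFun a fun i => (l i).sum := by
  have hsz : ∀ l : List ℕ, (enc l.sum).size ≤ (enc l).size := by
    intro l
    induction l with
    | nil => exact le_rfl
    | cons x l ih =>
      have := nat_size_add_le x l.sum
      simp only [enc_cons, enc_nat, Data.size, List.sum_cons] at ih ⊢
      omega
  have h := foldl (f := fun _ (s x : ℕ) => s + x) hl (nat 0)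
    ((acc _ _).add (elem _ _))
    ⟨_, hl.polyBdd_size, fun i l' h => by
      rw [← List.sum_eq_foldl]
      exact (hsz l').trans (size_enc_le_of_sublist h)⟩
  simpa only [List.sum_eq_foldl] using h

/-- Bit lengths are subadditive under multiplication. This keeps the common denominator short
although its value may be exponential. -/
theorem prod_list {l : ι → List ℕ} (hl : PolyFun a l) : PolyFun a fun i => (l i).prod := by
  have hsz : ∀ l : List ℕ, (enc l.prod).size ≤ (enc l).size + 1 := by
    intro l
    induction l with
    | nil => simp [enc_nat, enc_nil, Data.size]
    | cons x l ih =>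
      have := nat_size_mul_le x l.prod
      simp only [enc_cons, enc_nat, Data.size, List.prod_cons] at ih ⊢
      omega
  have h := foldl (f := fun _ (s x : ℕ) => s * x) hl (nat 1)
    ((acc _ _).mul (elem _ _))
    ⟨_, hl.polyBdd_size.add (.const 1), fun i l' h => by
      rw [← List.prod_eq_foldl]
      exact (hsz l').trans (Nat.succ_le_succ (size_enc_le_of_sublist h))⟩
  simpa only [List.prod_eq_foldl] using h

theorem length {l : ι → List α} (hl : PolyFun a l) : PolyFun a fun i => (l i).length := by
  simpa using (hl.map (f := fun _ _ => 1) (nat 1)).sum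

theorem sum_range {n : ι → ℕ} {f : ι → ℕ → ℕ} (hn : PolyFun a n) (hb : PolyBdd a n)
    (hf : PolyFun (ext a fun i => List.range (n i)) fun z => f z.1.1 z.1.2) :
    PolyFun a fun i => ∑ k ∈ Finset.range (n i), f i k :=
  ((range hn hb).map hf).sum

theorem count {l : ι → List ℕ} {x : ι → ℕ} (hl : PolyFun a l) (hx : PolyFun a x) :
    PolyFun a fun i => (l i).count (x i) := by
  have hcount : ∀ (l : List ℕ) (x : ℕ), l.count x = (l.map fun y => if y = x then 1 else 0).sum := by
    intro l x
    induction l with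
    | nil => rfl
    | cons y l ih => simp [List.count_cons, ih, add_comm]
  simp only [hcount]
  exact (hl.map (f := fun i y => if y = x i then 1 else 0)
    (ite (PolyDec.eq (var l) (hx.lift l)) (nat 1) (nat 0))).sum

/-- The tail is taken `k` times, hence the bound on the value of `k`. -/
theorem getD {l : ι → List α} {k : ι → ℕ} (d : α) (hl : PolyFun a l) (hk : PolyFun a k)
    (hb : PolyBdd a k) : PolyFun a fun i => (l i).getD (k i) d := by
  have hdrop : PolyFun a fun i => (l i).drop (k i) := by
    have hfold : ∀ (l : List α) (r : List ℕ),
        r.foldl (fun s _ => s.tail) l = l.drop r.length := by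
      intro l r
      induction r using List.reverseRecOn with
      | nil => rfl
      | append_singleton r x ih => simp [ih]
    have htail : ∀ l : List α, enc l.tail = Prim.snd.apply (enc l) := by
      intro l
      cases l <;> rfl
    have h := foldl (f := fun _ (s : List α) _ => s.tail) (range hk hb) hl
      (by
        unfold PolyFun
        simp only [htail]
        exact PolyTime.snd.comp (acc _ _))
      ⟨_, hl.polyBdd_size, fun i r _ => by
        rw [hfold]
        exact size_enc_le_of_sublist (List.drop_sublist _ _)⟩
    simpa [hfold] using h
  have hhead : ∀ (l : List α) (k : ℕ), enc (l.getD k d) =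
      if (Prim.isPair.apply (enc (l.drop k))).isTrue = true then
        Prim.fst.apply (enc (l.drop k)) else enc d := by
    intro l k
    rcases lt_or_ge k l.length with h | h
    · simp [enc_drop _ _ h, Prim.apply, Data.isTrue, h]
    · simp [List.drop_eq_nil_of_le h, enc_nil, Prim.apply, Data.isTrue, h]
  unfold PolyFun
  simp only [hhead]
  exact .test_cond (PolyTime.isPair.comp hdrop) (PolyTime.fst.comp hdrop) (const d)

end PolyFun

/-! ### Making an unweighted instance regular -/

/-- A constraint as a pair of numbers and lists of numbers. -/
abbrev RawConstraint : Type := ℕ × List ℕ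

/-- How often the variable `i` occurs in the constraint number `s`. -/
def occ (L : List RawConstraint) (s i : ℕ) : ℕ := (L.getD s (0, [])).2.count i

/-- How often the variable `i` occurs in the constraints before the constraint number `s`. -/
def rank (L : List RawConstraint) (s i : ℕ) : ℕ := ∑ k ∈ Finset.range s, occ L k i

/-- How often the variable `i` occurs. -/
def deg (L : List RawConstraint) (i : ℕ) : ℕ := rank L L.length i

/-- The number of occurrences of the variables smaller than `i`. -/
def offset (L : List RawConstraint) (i : ℕ) : ℕ := ∑ k ∈ Finset.range i, deg L k

/-- The copy of the variable `i` that is used in round `t` of the constraint number `s`. -/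
def copy (L : List RawConstraint) (M t s i : ℕ) : ℕ :=
  if t < deg L i * (M / deg L i) then t % deg L i else rank L s i

/-- The number of that copy among all copies of all variables. -/
def newVar (L : List RawConstraint) (M t s i : ℕ) : ℕ := offset L i + copy L M t s i

/-! ### Counting how often each copy of a variable is used -/

section Counting

variable {L : List RawConstraint} {i i' s t a a' M : ℕ}

theorem rank_mono (h : s ≤ t) : rank L s i ≤ rank L t i :=
  Finset.sum_le_sum_of_subset (Finset.range_mono h)

theorem rank_succ : rank L (s + 1) i = rank L s i + occ L s i := Finset.sum_range_succ _ _

theorem rank_lt_deg (hs : s < L.length) (h : 0 < occ L s i) : rank L s i < deg L i := by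
  have h₁ := rank_mono (L := L) (i := i) (Nat.succ_le_of_lt hs)
  rw [Nat.succ_eq_add_one, rank_succ] at h₁
  unfold deg
  omega

theorem offset_mono (h : i ≤ i') : offset L i ≤ offset L i' :=
  Finset.sum_le_sum_of_subset (Finset.range_mono h)

theorem offset_succ : offset L (i + 1) = offset L i + deg L i := Finset.sum_range_succ _ _

theorem copy_lt_deg (hs : s < L.length) (h : 0 < occ L s i) : copy L M t s i < deg L i := by
  have h₁ := rank_lt_deg hs h
  unfold copy
  split_ifs
  · exact Nat.mod_lt _ (by omega)
  · exact h₁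

theorem offset_add_lt (hi : i < i') (ha : a < deg L i) : offset L i + a < offset L i' := by
  have := offset_mono (L := L) (Nat.succ_le_of_lt hi)
  rw [Nat.succ_eq_add_one, offset_succ] at this
  omega

/-- The copies of the variables occupy consecutive disjoint blocks, of lengths `deg L i`. -/
theorem offset_add_inj (ha : a < deg L i) (ha' : a' < deg L i')
    (h : offset L i + a = offset L i' + a') : i = i' ∧ a = a' := by
  rcases lt_trichotomy i i' with hi | rfl | hi
  · have := offset_add_lt hi ha; omega
  · omega
  · have := offset_add_lt hi ha'; omega

theorem exists_offset_add {n v : ℕ} (hv : v < offset L n) :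
    ∃ i < n, ∃ a < deg L i, v = offset L i + a := by
  induction n with
  | zero => simp [offset] at hv
  | succ n ih =>
    rcases lt_or_ge v (offset L n) with h | h
    · obtain ⟨i, hi, h⟩ := ih h
      exact ⟨i, by omega, h⟩
    · rw [offset_succ] at hv
      exact ⟨n, by omega, v - offset L n, by omega, by omega⟩

/-- The rank grows in steps of 0 or 1, so each value below the final rank is the rank at exactly one
occurrence. -/
theorem sum_rank_eq (hocc : ∀ s, occ L s i ≤ 1) (W : ℕ) :
    (∑ s ∈ Finset.range W, if 0 < occ L s i ∧ rank L s i = a then 1 else 0) =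
      if a < rank L W i then 1 else 0 := by
  induction W with
  | zero => simp [rank]
  | succ W ih =>
    rw [Finset.sum_range_succ, ih, rank_succ]
    have := hocc W
    split_ifs <;> omega

theorem sum_occ_pos (hocc : ∀ s, occ L s i ≤ 1) (W : ℕ) :
    (∑ s ∈ Finset.range W, if 0 < occ L s i then 1 else 0) = rank L W i := by
  refine Finset.sum_congr rfl fun s _ => ?_
  have := hocc s
  split_ifs <;> omega

theorem sum_mod_eq {d : ℕ} (ha : a < d) (k : ℕ) :
    (∑ t ∈ Finset.range (d * k), if t % d = a then 1 else 0) = k := by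
  induction k with
  | zero => simp
  | succ k ih =>
    rw [mul_add, mul_one, Finset.sum_range_add, ih]
    congr 1
    rw [Finset.sum_eq_single_of_mem a (Finset.mem_range.2 ha)]
    · simp [Nat.mod_eq_of_lt ha]
    · intro b hb hba
      simp [Nat.mod_eq_of_lt (Finset.mem_range.1 hb), hba]

/-- Every copy of a variable is used equally often. -/
theorem sum_copy_eq (hocc : ∀ s, occ L s i ≤ 1) (ha : a < deg L i) (M : ℕ) :
    (∑ t ∈ Finset.range M, ∑ s ∈ Finset.range L.length,
      if 0 < occ L s i ∧ copy L M t s i = a then 1 else 0) = M := by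
  set d := deg L i with hd
  set T := d * (M / d) with hT
  have hTM : T ≤ M := Nat.mul_div_le M d
  obtain ⟨R, hR⟩ := Nat.exists_eq_add_of_le hTM
  -- In a periodic round all `d` occurrences use the same copy; the `M / d` periods together give
  -- each copy `T` uses.
  have h₁ : ∀ t < T, (∑ s ∈ Finset.range L.length,
      if 0 < occ L s i ∧ copy L M t s i = a then 1 else 0) = d * if t % d = a then 1 else 0 := by
    intro t ht
    have hc : ∀ s, copy L M t s i = t % d := fun s => by rw [copy, ← hd, ← hT, if_pos ht]
    simp only [hc]
    split_ifs with h
    · simp only [h, and_true, sum_occ_pos hocc]; rw [mul_one]; rfl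
    · simp [h]
  -- In each of the `R` remaining rounds the occurrences use distinct copies, one use per copy; the
  -- total is `T + R = M`.
  have h₂ : ∀ t ≥ T, (∑ s ∈ Finset.range L.length,
      if 0 < occ L s i ∧ copy L M t s i = a then 1 else 0) = 1 := by
    intro t ht
    have hc : ∀ s, copy L M t s i = rank L s i := fun s => by
      rw [copy, ← hd, ← hT, if_neg (by omega)]
    simp only [hc, sum_rank_eq hocc]
    exact if_pos ha
  conv_lhs => rw [show Finset.range M = Finset.range (T + R) by rw [← hR]]
  rw [Finset.sum_range_add, Finset.sum_congr rfl fun t ht => h₁ t (Finset.mem_range.1 ht),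
    ← Finset.mul_sum, hT, sum_mod_eq ha, ← hT,
    Finset.sum_congr rfl fun t _ => h₂ (T + t) (Nat.le_add_right _ _)]
  simp only [Finset.sum_const, Finset.card_range, smul_eq_mul, mul_one]
  omega

end Counting

variable {Λ : CSP}

/-- The pair of numbers that represents a constraint. -/
def Constraint.raw {n : ℕ} (C : Constraint Λ n) : RawConstraint :=
  (C.idx, List.ofFn fun j => (C.scope j : ℕ))

/-- The list that represents the constraints of an instance. -/
def Instance.raw (F : Instance Λ) : List RawConstraint := List.ofFn fun r => (F.constr r).raw

theorem Constraint.count_raw {n : ℕ} (C : Constraint Λ n) (i : ℕ) : C.raw.2.count i ≤ 1 := by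
  refine List.nodup_iff_count_le_one.1 ?_ i
  rw [Constraint.raw, List.nodup_ofFn]
  exact Fin.val_injective.comp C.scope.injective

theorem Constraint.count_raw_pos {n : ℕ} (C : Constraint Λ n) (i : ℕ) :
    0 < C.raw.2.count i ↔ ∃ j, (C.scope j : ℕ) = i := by
  rw [List.count_pos_iff, Constraint.raw, List.mem_ofFn]

/-! ### The regularized instance: degrees, lifting and rounding of assignments -/

namespace Instance

variable (F : Instance Λ)

@[simp] theorem length_raw : F.raw.length = F.m := by simp [raw]

theorem getD_raw (s : Fin F.m) : F.raw.getD s (0, []) = (F.constr s).raw := by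
  simp [raw]

theorem occ_raw_le (s i : ℕ) : occ F.raw s i ≤ 1 := by
  rcases lt_or_ge s F.m with h | h
  · have := F.getD_raw ⟨s, h⟩
    rw [occ, this]
    exact Constraint.count_raw _ _
  · simp [occ, h]

theorem occ_raw_pos (s : Fin F.m) (i : ℕ) :
    0 < occ F.raw s i ↔ ∃ j, ((F.constr s).scope j : ℕ) = i := by
  rw [occ, getD_raw, Constraint.count_raw_pos]

theorem occ_scope_pos (s : Fin F.m) (j) : 0 < occ F.raw s ((F.constr s).scope j) :=
  (F.occ_raw_pos s _).2 ⟨j, rfl⟩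

theorem copy_scope_lt (M t : ℕ) (s : Fin F.m) (j) :
    copy F.raw M t s ((F.constr s).scope j) < deg F.raw ((F.constr s).scope j) :=
  copy_lt_deg (by simp) (F.occ_scope_pos s j)

/-- Every variable is replaced by as many copies as it has occurrences, and every constraint by
`M` constraints on these copies. -/
def regularize (M : ℕ) : Instance Λ where
  -- This is the sum of all degrees: a variable that occurs nowhere has no copies and disappears.
  n := offset F.raw F.n
  m := M * F.m
  constr r :=
    { idx := (F.constr r.modNat).idx
      scope :=
        { toFun := fun j => ⟨newVar F.raw M r.divNat r.modNat ((F.constr r.modNat).scope j),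
            offset_add_lt ((F.constr r.modNat).scope j).2 (F.copy_scope_lt M _ _ j)⟩
          inj' := fun j j' h => (F.constr r.modNat).scope.injective <| Fin.ext <|
            (offset_add_inj (F.copy_scope_lt M _ _ j) (F.copy_scope_lt M _ _ j')
              (Fin.mk.inj h)).1 } }

theorem sum_divNat_modNat {A : Type} [AddCommMonoid A] (M W : ℕ) (f : Fin M → Fin W → A) :
    ∑ r : Fin (M * W), f r.divNat r.modNat = ∑ t, ∑ s, f t s := by
  rw [← Fintype.sum_prod_type', ← Equiv.sum_comp finProdFinEquiv.symm]
  rfl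

theorem degree_regularize (M : ℕ) (v : Fin (F.regularize M).n) :
    (F.regularize M).degree v = M := by
  classical
  obtain ⟨i, hi, a, ha, hv⟩ := exists_offset_add v.2
  have hiff : ∀ r : Fin (M * F.m), (∃ j, ((F.regularize M).constr r).scope j = v) ↔
      0 < occ F.raw r.modNat i ∧ copy F.raw M r.divNat r.modNat i = a := by
    intro r
    rw [occ_raw_pos]
    constructor
    · rintro ⟨j, hj⟩
      have hj := congrArg Fin.val hj
      rw [hv] at hj
      obtain ⟨h₁, h₂⟩ := offset_add_inj (F.copy_scope_lt M r.divNat r.modNat j) ha hj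
      exact ⟨⟨j, h₁⟩, h₁ ▸ h₂⟩
    · rintro ⟨⟨j, hj⟩, h⟩
      refine ⟨j, Fin.ext ?_⟩
      rw [hv, ← h, ← hj]
      rfl
  have hsum := sum_copy_eq (fun s => F.occ_raw_le s i) ha M
  rw [length_raw, Finset.sum_range] at hsum
  simp only [Finset.sum_range] at hsum
  rw [degree, Nat.card_eq_fintype_card, Fintype.card_subtype, Finset.card_filter]
  refine Eq.trans ?_ ((sum_divNat_modNat M F.m fun t s =>
    if 0 < occ F.raw s i ∧ copy F.raw M t s i = a then 1 else 0).trans hsum)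
  exact Finset.sum_congr rfl fun r _ => if_congr (hiff r) rfl rfl

theorem regular_regularize (M : ℕ) : (F.regularize M).Regular := ⟨M, F.degree_regularize M⟩

/-- The number of constraints satisfied by an assignment. -/
def satCount (χ : F.Assignment) : ℕ :=
  ∑ r, if (Λ.pred (F.constr r).idx).holds (fun j => χ ((F.constr r).scope j)) = true then 1 else 0

theorem val_uniform (hm : 0 < F.m) (χ : F.Assignment) :
    (F.uniform hm).val χ = (F.satCount χ : ℚ≥0) / F.m := by
  simp only [WeightedInstance.val, uniform, Constraint.eval, satCount, ← Finset.mul_sum]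
  push_cast
  rw [one_div, inv_mul_eq_div]
  rfl

/-- The assignment that gives to all copies of a variable the value of the variable. -/
noncomputable def liftAssignment (M : ℕ) (χ : F.Assignment) : (F.regularize M).Assignment :=
  fun v => χ ⟨(exists_offset_add v.2).choose, (exists_offset_add v.2).choose_spec.1⟩

theorem liftAssignment_apply (M : ℕ) (χ : F.Assignment) (i : Fin F.n) (a : ℕ)
    (ha : a < deg F.raw i) (v : Fin (F.regularize M).n) (hv : (v : ℕ) = offset F.raw i + a) :
    F.liftAssignment M χ v = χ i := by
  obtain ⟨a', ha', h⟩ := (exists_offset_add v.2).choose_spec.2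
  exact congrArg χ (Fin.ext (offset_add_inj ha' ha (h.symm.trans hv)).1)

/-- All copies of a variable agree, so each of the `M` rounds reproduces the original evaluation. -/
theorem satCount_liftAssignment (M : ℕ) (χ : F.Assignment) :
    (F.regularize M).satCount (F.liftAssignment M χ) = M * F.satCount χ := by
  have h : ∀ (r : Fin (M * F.m)) (j), F.liftAssignment M χ
      (((F.regularize M).constr r).scope j) = χ ((F.constr r.modNat).scope j) := fun r j =>
    F.liftAssignment_apply M χ _ _ (F.copy_scope_lt M r.divNat r.modNat j) _ rfl
  have := sum_divNat_modNat M F.m fun _ s => if (Λ.pred (F.constr s).idx).holds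
    (fun j => χ ((F.constr s).scope j)) = true then 1 else 0
  rw [Finset.sum_const, Finset.card_univ, Fintype.card_fin, smul_eq_mul] at this
  refine Eq.trans (Finset.sum_congr rfl fun r _ => ?_) this
  refine if_congr (Eq.congr_left ?_) rfl rfl
  exact congrArg _ (funext fun j => h r j)

/-- The assignment that gives to every variable the value of its copy number `t`, modulo the number
of its copies. -/
def roundAssignment (hq : 0 < Λ.q) (M t : ℕ) (χ : (F.regularize M).Assignment) : F.Assignment :=
  -- For degree 0 the remainder is `t` itself and the index may be out of range; the value then does
  -- not matter, as the variable is in no scope.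
  fun i => if h : offset F.raw i + t % deg F.raw i < (F.regularize M).n then χ ⟨_, h⟩ else ⟨0, hq⟩

theorem deg_raw_le (i : ℕ) : deg F.raw i ≤ F.m := by
  have h := Finset.sum_le_sum fun s (_ : s ∈ Finset.range F.m) => F.occ_raw_le s i
  simpa [deg, rank] using h

/-- The periodic rounds of a variable end less than `deg` rounds before `M`, and `deg` is at most
`F.m`. So a round before `M - F.m` is periodic for all variables at once, and the copy used depends
on `t` and the variable but not on the constraint. -/
theorem roundAssignment_scope (hq : 0 < Λ.q) (M t : ℕ) (ht : t < M - F.m)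
    (χ : (F.regularize M).Assignment) (s : Fin F.m) (j) :
    F.roundAssignment hq M t χ ((F.constr s).scope j) =
      χ ⟨newVar F.raw M t s ((F.constr s).scope j),
        offset_add_lt ((F.constr s).scope j).2 (F.copy_scope_lt M _ _ j)⟩ := by
  have hd := F.copy_scope_lt M t s j
  set i := (F.constr s).scope j
  have hlt : t < deg F.raw i * (M / deg F.raw i) := by
    have h₁ := Nat.div_add_mod M (deg F.raw i)
    have h₂ := Nat.mod_lt M (by omega : 0 < deg F.raw i)
    have h₃ := F.deg_raw_le i
    omega
  have hnew : newVar F.raw M t s i = offset F.raw i + t % deg F.raw i := by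
    rw [newVar, copy, if_pos hlt]
  have hN : offset F.raw i + t % deg F.raw i < (F.regularize M).n :=
    offset_add_lt i.2 (Nat.mod_lt _ (by omega))
  rw [roundAssignment, dif_pos hN]
  exact congrArg χ (Fin.ext hnew.symm)

theorem sum_satCount_roundAssignment_le (hq : 0 < Λ.q) (M : ℕ)
    (χ : (F.regularize M).Assignment) :
    ∑ t ∈ Finset.range (M - F.m), F.satCount (F.roundAssignment hq M t χ) ≤
      (F.regularize M).satCount χ := by
  have h := sum_divNat_modNat M F.m fun t s => if (Λ.pred (F.constr s).idx).holds
    (fun j => χ ⟨newVar F.raw M t s ((F.constr s).scope j),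
        offset_add_lt ((F.constr s).scope j).2 (F.copy_scope_lt M _ _ j)⟩) = true then 1 else 0
  have h' : (F.regularize M).satCount χ = _ := h
  rw [h', ← Finset.sum_range fun t => ∑ s : Fin F.m, if (Λ.pred (F.constr s).idx).holds
    (fun j => χ ⟨newVar F.raw M t s ((F.constr s).scope j),
        offset_add_lt ((F.constr s).scope j).2 (F.copy_scope_lt M _ _ j)⟩) = true then 1 else 0]
  refine le_trans (le_of_eq ?_)
    (Finset.sum_le_sum_of_subset (Finset.range_mono (Nat.sub_le M F.m)))
  refine Finset.sum_congr rfl fun t ht => Finset.sum_congr rfl fun s _ => ?_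
  simp only [F.roundAssignment_scope hq M t (Finset.mem_range.1 ht)]

/-- An approximate solution of the regular instance yields one of the original instance. -/
theorem exists_satCount_roundAssignment_le (hq : 0 < Λ.q) {M : ℕ} (hM : F.m < M) {α : ℝ}
    (hα : 0 ≤ α) (hm : 0 < (F.regularize M).m) (χ : (F.regularize M).Assignment)
    (hχ : ((((F.regularize M).uniform hm).val χ : ℚ≥0) : ℝ) ≤
      α * ((F.regularize M).uniform hm).opt) :
    ∃ t < M, ∀ ψ : F.Assignment, ((M - F.m : ℕ) : ℝ) * F.satCount (F.roundAssignment hq M t χ) ≤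
      α * (M * F.satCount ψ) := by
  -- The best round does not exceed the average; it is chosen before `ψ`.
  obtain ⟨t, ht, hmin⟩ := Finset.exists_min_image (Finset.range (M - F.m))
    (fun t => F.satCount (F.roundAssignment hq M t χ)) ⟨0, Finset.mem_range.2 (by omega)⟩
  rw [Finset.mem_range] at ht
  refine ⟨t, by omega, fun ψ => ?_⟩
  have h₁ : (M - F.m) * F.satCount (F.roundAssignment hq M t χ) ≤
      (F.regularize M).satCount χ := by
    refine le_trans ?_ (F.sum_satCount_roundAssignment_le hq M χ)
    simpa using Finset.card_nsmul_le_sum _ _ _ hmin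
  have h₂ : ((F.regularize M).uniform hm).opt ≤
      (((F.regularize M).uniform hm).val (F.liftAssignment M ψ) : ℚ≥0) :=
    ciInf_le (Set.finite_range _).bddBelow (F.liftAssignment M ψ)
  have h₃ := hχ.trans (mul_le_mul_of_nonneg_left h₂ hα)
  rw [val_uniform, val_uniform, satCount_liftAssignment] at h₃
  push_cast at h₃
  have hm' : (0 : ℝ) < (F.regularize M).m := by exact_mod_cast hm
  rw [mul_div_assoc', div_le_div_iff_of_pos_right hm'] at h₃
  exact le_trans (by exact_mod_cast h₁) h₃

end Instance

/-! ### From weights to multiplicities -/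

/-- The value of a constraint as a natural number. -/
def Constraint.sat {n : ℕ} (C : Constraint Λ n) (χ : Fin n → Fin Λ.q) : ℕ :=
  if (Λ.pred C.idx).holds (fun j => χ (C.scope j)) = true then 1 else 0

theorem Constraint.sat_le_one {n : ℕ} (C : Constraint Λ n) (χ : Fin n → Fin Λ.q) :
    C.sat χ ≤ 1 := by
  unfold sat
  split_ifs <;> omega

theorem Constraint.eval_eq_sat {n : ℕ} (C : Constraint Λ n) (χ : Fin n → Fin Λ.q) :
    C.eval χ = C.sat χ := by
  unfold eval sat
  split_ifs <;> simp

/-- How often a constraint of weight `u` is repeated if constraints of a weight much larger than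
`w` are known to be unsatisfied. -/
def multiplicity (K B m w u : ℕ) : ℕ := min ((u * (K * m) + (w - 1)) / w) (B * (m * m))

section Multiplicity

variable {K B m w u : ℕ}

/-- Rounding up keeps zero at zero, so an optimum of value 0 survives the scaling. -/
theorem multiplicity_zero (hw : 1 ≤ w) : multiplicity K B m w 0 = 0 := by
  simp [multiplicity, Nat.div_eq_of_lt (by omega : w - 1 < w)]

theorem mul_multiplicity_le : w * multiplicity K B m w u ≤ u * (K * m) + w := by
  have h := Nat.mul_div_le (u * (K * m) + (w - 1)) w
  have h' := Nat.mul_le_mul_left w (min_le_left ((u * (K * m) + (w - 1)) / w) (B * (m * m)))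
  unfold multiplicity
  omega

/-- The summand `w - 1` makes the division round up, which gives this lower bound as long as the cap
is not reached. -/
theorem le_mul_multiplicity (hw : 1 ≤ w) (h : multiplicity K B m w u < B * (m * m)) :
    u * (K * m) ≤ w * multiplicity K B m w u := by
  unfold multiplicity at h ⊢
  have h₁ : (u * (K * m) + (w - 1)) / w ≤ B * (m * m) := by
    by_contra h'
    rw [min_eq_right (by omega)] at h
    omega
  rw [min_eq_left h₁]
  have h₂ := Nat.div_add_mod (u * (K * m) + (w - 1)) w
  have h₃ := Nat.mod_lt (u * (K * m) + (w - 1)) (by omega : 0 < w)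
  omega

theorem multiplicity_pos (hw : 1 ≤ w) (hK : 0 < K) (hB : 0 < B) (hm : 0 < m) (hu : 0 < u) :
    0 < multiplicity K B m w u := by
  have h : 0 < u * (K * m) := by positivity
  exact lt_min (Nat.div_pos (by omega) (by omega)) (by positivity)

/-- Approximate solutions for the multiplicities are approximate solutions for the weights. -/
theorem sum_le_of_sum_multiplicity_le {α : ℝ} (hα : 0 ≤ α) (hK : 2 ≤ K)
    (hB : α * (K * (K + 1)) < B) (hm : 0 < m) (hw : 1 ≤ w) {u x y : Fin m → ℕ}
    (hx : ∀ r, x r ≤ 1) (hy : ∀ r, y r ≤ 1) (hxw : ∀ r, x r = 1 → u r ≤ w)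
    (hcost : ∑ r, u r * x r = 0 ∨ w ≤ ∑ r, u r * x r)
    (h : ((K : ℝ) - 1) * (∑ r, multiplicity K B m w (u r) * y r : ℕ) ≤
      α * (K * (∑ r, multiplicity K B m w (u r) * x r : ℕ))) :
    ((K : ℝ) - 1) * (∑ r, u r * y r : ℕ) ≤ α * (K + 1) * (∑ r, u r * x r : ℕ) := by
  set c := ∑ r, u r * x r with hc
  set d := ∑ r, u r * y r with hd
  set cv := ∑ r, multiplicity K B m w (u r) * x r with hcv
  set dv := ∑ r, multiplicity K B m w (u r) * y r with hdv
  -- The rounding error is at most `w` per constraint, hence `m * w ≤ m * c` in total when `w ≤ c`.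
  have h₁ : w * cv ≤ (K + 1) * m * c := by
    rcases hcost with h0 | hwc
    · have : cv = 0 := by
        refine Finset.sum_eq_zero fun r _ => ?_
        have := Finset.sum_eq_zero_iff.1 h0 r (Finset.mem_univ r)
        rcases Nat.mul_eq_zero.1 this with h | h
        · rw [h, multiplicity_zero hw, zero_mul]
        · rw [h, mul_zero]
      simp [this]
    · have : w * cv ≤ ∑ r : Fin m, (u r * x r * (K * m) + w) := by
        rw [hcv, Finset.mul_sum]
        refine Finset.sum_le_sum fun r _ => ?_
        have h1 := hx r
        have h2 := mul_multiplicity_le (K := K) (B := B) (m := m) (w := w) (u := u r)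
        interval_cases x r
        · simp
        · simpa using h2
      rw [Finset.sum_add_distrib, ← Finset.sum_mul, ← hc] at this
      simp only [Finset.sum_const, Finset.card_univ, Fintype.card_fin, smul_eq_mul] at this
      nlinarith [Nat.mul_le_mul_left m hwc]
  have h₂ : c ≤ m * w := by
    have : c ≤ ∑ _r : Fin m, w := by
      refine Finset.sum_le_sum fun r _ => ?_
      have h1 := hx r
      have h2 := hxw r
      interval_cases x r
      · simp
      · simpa using h2 rfl
    simpa using this
  have h₃ : cv ≤ (K + 1) * m * m := by
    have : w * cv ≤ w * ((K + 1) * m * m) := by nlinarith [Nat.mul_le_mul_left ((K + 1) * m) h₂]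
    exact Nat.le_of_mul_le_mul_left this (by omega)
  have hK' : (2 : ℝ) ≤ K := by exact_mod_cast hK
  have hm' : (0 : ℝ) < m := by exact_mod_cast hm
  have h₃' : (cv : ℝ) ≤ (K + 1) * m * m := by exact_mod_cast h₃
  -- A single capped constraint in `y` would already exceed what the approximation guarantee and the
  -- bound on `cv` allow.
  have hsmall : ∀ r, y r = 1 → multiplicity K B m w (u r) < B * (m * m) := by
    intro r hr
    by_contra hcap
    have h4 : B * (m * m) ≤ dv := by
      refine (not_lt.1 hcap).trans ?_
      refine le_trans (by rw [hr, mul_one]) (Finset.single_le_sum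
        (f := fun r => multiplicity K B m w (u r) * y r) (fun _ _ => Nat.zero_le _)
        (Finset.mem_univ r))
    have h4' : (B : ℝ) * (m * m) ≤ dv := by exact_mod_cast h4
    have h5 : (B : ℝ) * (m * m) ≤ α * (K * ((K + 1) * m * m)) := by
      calc (B : ℝ) * (m * m) ≤ dv := h4'
        _ ≤ ((K : ℝ) - 1) * dv := by nlinarith [(Nat.cast_nonneg dv : (0 : ℝ) ≤ dv)]
        _ ≤ α * (K * cv) := h
        _ ≤ α * (K * ((K + 1) * m * m)) := by gcongr
    have h6 : (B : ℝ) * (m * m) ≤ α * (K * (K + 1)) * (m * m) := by nlinarith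
    exact absurd (le_of_mul_le_mul_right h6 (by positivity)) (not_le.2 hB)
  have h₄ : K * m * d ≤ w * dv := by
    rw [hd, hdv, Finset.mul_sum, Finset.mul_sum]
    refine Finset.sum_le_sum fun r _ => ?_
    have h1 := hy r
    have h2 := hsmall r
    interval_cases y r
    · simp
    · have := le_mul_multiplicity hw (h2 rfl)
      simp only [mul_one]
      linarith
  have h₁' : (w : ℝ) * cv ≤ (K + 1) * m * c := by exact_mod_cast h₁
  have h₄' : (K : ℝ) * m * d ≤ w * dv := by exact_mod_cast h₄
  have hKm : (0 : ℝ) < K * m := by positivity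
  refine le_of_mul_le_mul_left ?_ hKm
  calc (K : ℝ) * m * ((K - 1) * d) = (K - 1) * (K * m * d) := by ring
    _ ≤ (K - 1) * (w * dv) := mul_le_mul_of_nonneg_left h₄' (by linarith)
    _ = w * ((K - 1) * dv) := by ring
    _ ≤ w * (α * (K * cv)) := mul_le_mul_of_nonneg_left h (by positivity)
    _ = α * K * (w * cv) := by ring
    _ ≤ α * K * ((K + 1) * m * c) := mul_le_mul_of_nonneg_left h₁' (by positivity)
    _ = K * m * (α * (K + 1) * c) := by ring

end Multiplicity

/-! ### Repeating constraints -/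

/-- The instance in which the constraint number `r` is repeated `v r` times. -/
def Instance.expand (F : Instance Λ) (v : Fin F.m → ℕ) : Instance Λ where
  n := F.n
  m := ((List.finRange F.m).flatMap fun r => List.replicate (v r) (F.constr r)).length
  constr := ((List.finRange F.m).flatMap fun r => List.replicate (v r) (F.constr r)).get

theorem Instance.raw_expand (F : Instance Λ) (v : Fin F.m → ℕ) :
    (F.expand v).raw =
      (List.finRange F.m).flatMap fun r => List.replicate (v r) (F.constr r).raw := by
  have : (F.expand v).raw = ((List.finRange F.m).flatMap fun r =>
      List.replicate (v r) (F.constr r)).map Constraint.raw := by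
    refine List.ext_getElem (by simp [raw, expand]) fun k h₁ h₂ => ?_
    simp [raw, expand]
  rw [this, List.map_flatMap]
  simp

theorem Instance.satCount_expand (F : Instance Λ) (v : Fin F.m → ℕ) (χ : F.Assignment) :
    (F.expand v).satCount χ = ∑ r, v r * (F.constr r).sat χ := by
  have h₁ : (F.expand v).satCount χ = (((List.finRange F.m).flatMap fun r =>
      List.replicate (v r) (F.constr r)).map fun C => C.sat χ).sum := by
    rw [← Fin.sum_univ_fun_getElem]
    rfl
  rw [h₁, List.map_flatMap, List.flatMap_def, List.sum_flatten, List.map_map, ← List.ofFn_eq_map,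
    List.sum_ofFn]
  simp

/-! ### Integral weights, guesses of the largest satisfied weight, and the combined rounding -/

namespace WeightedInstance

variable (F : WeightedInstance Λ)

/-- The list that represents the constraints of a weighted instance. -/
def rawWeighted : List (RawConstraint × ℕ × ℕ) :=
  List.ofFn fun r => ((F.constr r).raw, (F.weight r).num, (F.weight r).den)

/-- A common denominator of the weights. -/
def commonDen : ℕ := (F.rawWeighted.map fun x => x.2.2).prod

/-- The weights multiplied by the common denominator. -/
def intWeight (r : Fin F.m) : ℕ := (F.weight r).num * (F.commonDen / (F.weight r).den)

/-- The constraints with their integral weights. -/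
def rawInt : List (RawConstraint × ℕ) :=
  F.rawWeighted.map fun x => (x.1, x.2.1 * (F.commonDen / x.2.2))

theorem rawInt_eq : F.rawInt = List.ofFn fun r => ((F.constr r).raw, F.intWeight r) := by
  simp [rawInt, rawWeighted, intWeight, Function.comp_def, List.map_ofFn]

theorem commonDen_eq : F.commonDen = ∏ r, (F.weight r).den := by
  simp [commonDen, rawWeighted, List.map_ofFn, List.prod_ofFn]

theorem commonDen_pos : 0 < F.commonDen := by
  rw [commonDen_eq]
  exact Finset.prod_pos fun r _ => (F.weight r).den_pos

theorem intWeight_cast (r : Fin F.m) : (F.intWeight r : ℚ≥0) = F.commonDen * F.weight r := by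
  have hdvd : (F.weight r).den ∣ F.commonDen := by
    rw [commonDen_eq]
    exact Finset.dvd_prod_of_mem _ (Finset.mem_univ r)
  have hne : ((F.weight r).den : ℚ≥0) ≠ 0 := by exact_mod_cast (F.weight r).den_pos.ne'
  rw [intWeight, Nat.cast_mul, Nat.cast_div hdvd hne]
  conv_rhs => rw [← NNRat.num_div_den (F.weight r)]
  field_simp

/-- The value of an assignment, multiplied by the common denominator. -/
def cost (χ : F.Assignment) : ℕ := ∑ r, F.intWeight r * (F.constr r).sat χ

theorem cost_cast (χ : F.Assignment) : (F.cost χ : ℚ≥0) = F.commonDen * F.val χ := by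
  simp only [cost, val, Nat.cast_sum, Nat.cast_mul, intWeight_cast, Constraint.eval_eq_sat,
    Finset.mul_sum, mul_assoc]

theorem exists_intWeight_pos : ∃ r, 0 < F.intWeight r := by
  by_contra! h
  have h0 : ∀ r, F.weight r = 0 := by
    intro r
    have h1 := F.intWeight_cast r
    rw [Nat.le_zero.1 (h r), Nat.cast_zero, zero_eq_mul] at h1
    exact h1.resolve_left (by exact_mod_cast F.commonDen_pos.ne')
  have := F.weight_sum
  simp [h0] at this

theorem m_pos : 0 < F.m := by
  obtain ⟨r, _⟩ := F.exists_intWeight_pos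
  exact r.pos

theorem val_le_mul_opt {β : ℝ} (χ : F.Assignment)
    (h : ∀ ψ, (F.cost χ : ℝ) ≤ β * F.cost ψ) : (F.val χ : ℝ) ≤ β * F.opt := by
  have : Nonempty F.Assignment := ⟨χ⟩
  obtain ⟨ψ, hψ⟩ := exists_eq_ciInf_of_finite (f := fun ψ : F.Assignment => (F.val ψ : ℝ))
  have hcast : ∀ ψ, (F.cost ψ : ℝ) = F.commonDen * (F.val ψ : ℝ) := by
    intro ψ
    exact_mod_cast congrArg (fun x : ℚ≥0 => (x : ℝ)) (F.cost_cast ψ)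
  have h' := h ψ
  rw [hcast, hcast, mul_left_comm] at h'
  rw [opt, ← hψ]
  exact le_of_mul_le_mul_left h' (by exact_mod_cast F.commonDen_pos)

/-- The instance with multiplicities that belongs to the guess `w`. -/
def scaled (K B w : ℕ) : Instance Λ :=
  F.expand fun r => multiplicity K B F.m w (F.intWeight r)

/-- The regular instance that belongs to the guess `w`. -/
def regularized (K B w : ℕ) : Instance Λ :=
  -- With `K` times as many rounds as constraints, the rounds ignored in the rounding are a fraction
  -- `1 / K`.
  (F.scaled K B w).regularize (K * (F.scaled K B w).m)

theorem scaled_m_pos {K B w : ℕ} (hK : 0 < K) (hB : 0 < B) (hw : 1 ≤ w) :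
    0 < (F.scaled K B w).m := by
  obtain ⟨r, hr⟩ := F.exists_intWeight_pos
  have hpos := multiplicity_pos hw hK hB F.m_pos hr
  refine List.length_pos_of_mem (a := F.constr r) ?_
  exact List.mem_flatMap.2 ⟨r, List.mem_finRange r, List.mem_replicate.2 ⟨hpos.ne', rfl⟩⟩

theorem regularized_m_pos {K B w : ℕ} (hK : 0 < K) (hB : 0 < B) (hw : 1 ≤ w) :
    0 < (F.regularized K B w).m :=
  Nat.mul_pos (Nat.mul_pos hK (F.scaled_m_pos hK hB hw)) (F.scaled_m_pos hK hB hw)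

theorem regular_regularized (K B w : ℕ) : (F.regularized K B w).Regular :=
  Instance.regular_regularize _ _

/-- The guesses of the largest weight of a satisfied constraint. -/
def guesses : List ℕ := F.rawInt.map fun x => x.2 + (1 - x.2)

theorem mem_guesses {w : ℕ} : w ∈ F.guesses ↔ ∃ r, F.intWeight r + (1 - F.intWeight r) = w := by
  simp [guesses, rawInt_eq, List.mem_ofFn]

/-- By truncated subtraction `u + (1 - u)` is the maximum of `u` and 1, so guesses are legitimate
divisors. -/
theorem one_le_of_mem_guesses {w : ℕ} (h : w ∈ F.guesses) : 1 ≤ w := by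
  obtain ⟨r, rfl⟩ := F.mem_guesses.1 h
  omega

/-- Take the largest weight of a constraint satisfied by `ψ`; it is part of the cost. If it is 0,
the guess is 1 and the last alternative is automatic for natural numbers; if nothing is satisfied,
any guess works. -/
theorem exists_guess (ψ : F.Assignment) : ∃ w ∈ F.guesses,
    (∀ r, (F.constr r).sat ψ = 1 → F.intWeight r ≤ w) ∧ (F.cost ψ = 0 ∨ w ≤ F.cost ψ) := by
  by_cases hne : ∃ r, (F.constr r).sat ψ = 1
  · obtain ⟨r₀, hr₀⟩ := hne
    obtain ⟨r, hr, hmax⟩ := Finset.exists_max_image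
      (Finset.univ.filter fun r => (F.constr r).sat ψ = 1) F.intWeight ⟨r₀, by simpa using hr₀⟩
    simp only [Finset.mem_filter, Finset.mem_univ, true_and] at hr hmax
    refine ⟨_, F.mem_guesses.2 ⟨r, rfl⟩, fun r' hr' => (hmax r' hr').trans (Nat.le_add_right _ _), ?_⟩
    have : F.intWeight r ≤ F.cost ψ := by
      refine le_trans (by rw [hr, mul_one]) (Finset.single_le_sum
        (f := fun r => F.intWeight r * (F.constr r).sat ψ) (fun _ _ => Nat.zero_le _)
        (Finset.mem_univ r))
    omega
  · push Not at hne
    obtain ⟨r, _⟩ := F.exists_intWeight_pos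
    refine ⟨_, F.mem_guesses.2 ⟨r, rfl⟩, fun r hr => absurd hr (hne r), Or.inl ?_⟩
    refine Finset.sum_eq_zero fun r _ => ?_
    have h₁ := hne r
    have h₂ := (F.constr r).sat_le_one ψ
    rw [show (F.constr r).sat ψ = 0 by omega, mul_zero]

/-- If all regular instances are solved approximately, then one of the rounded solutions is good. -/
theorem exists_round_cost_le {K B : ℕ} {α : ℝ} (hα : 0 ≤ α) (hK : 2 ≤ K)
    (hB : α * (K * (K + 1)) < B) (hB' : 0 < B) (hq : 0 < Λ.q)
    (sol : ∀ w, (F.regularized K B w).Assignment)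
    (hsol : ∀ w (hw : 1 ≤ w),
      ((((F.regularized K B w).uniform (F.regularized_m_pos (by omega) hB' hw)).val (sol w) :
        ℚ≥0) : ℝ) ≤
      α * ((F.regularized K B w).uniform (F.regularized_m_pos (by omega) hB' hw)).opt)
    (ψ : F.Assignment) :
    ∃ w ∈ F.guesses, ∃ t < K * (F.scaled K B w).m,
      ((K : ℝ) - 1) * F.cost ((F.scaled K B w).roundAssignment hq _ t (sol w)) ≤
        α * (K + 1) * F.cost ψ := by
  obtain ⟨w, hw, hle, hcost⟩ := F.exists_guess ψ
  have hw1 := F.one_le_of_mem_guesses hw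
  have hG := F.scaled_m_pos (K := K) (by omega) hB' hw1
  obtain ⟨t, ht, hround⟩ := (F.scaled K B w).exists_satCount_roundAssignment_le hq
    (M := K * (F.scaled K B w).m) (by nlinarith) hα (F.regularized_m_pos (by omega) hB' hw1)
    (sol w) (hsol w hw1)
  refine ⟨w, hw, t, ht, ?_⟩
  refine sum_le_of_sum_multiplicity_le (w := w) hα hK hB F.m_pos hw1
    (fun r => Constraint.sat_le_one _ _) (fun r => Constraint.sat_le_one _ _) hle hcost ?_
  have h := hround ψ
  have h₁ := F.satCount_expand (fun r => multiplicity K B F.m w (F.intWeight r)) ψ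
  have h₂ := F.satCount_expand (fun r => multiplicity K B F.m w (F.intWeight r))
    ((F.scaled K B w).roundAssignment hq _ t (sol w))
  change (F.scaled K B w).satCount ψ = _ at h₁
  change (F.scaled K B w).satCount _ = _ at h₂
  rw [h₁, h₂] at h
  have hG' : (0 : ℝ) < (F.scaled K B w).m := by exact_mod_cast hG
  rw [Nat.cast_sub (by nlinarith), Nat.cast_mul] at h
  refine le_of_mul_le_mul_left ?_ hG'
  linarith

end WeightedInstance

/-! ### Encodings as lists of numbers -/

theorem enc_list_ofFn {α : Type} [Enc α] {n : ℕ} (f : Fin n → α) :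
    enc (List.ofFn f) = Data.ofList (List.ofFn fun i => enc (f i)) := by
  change Data.ofList ((List.ofFn f).map enc) = _
  rw [List.map_ofFn]
  rfl

theorem encodeVars_eq (n : ℕ) : encodeVars n = enc (List.range n) := by
  have h : List.range n = List.ofFn fun i : Fin n => (i : ℕ) :=
    List.ext_getElem (by simp) fun k h₁ h₂ => by simp
  rw [h, enc_list_ofFn]
  rfl

theorem Constraint.enc_raw {n : ℕ} (C : Constraint Λ n) : enc C.raw = C.encode := by
  rw [Constraint.raw, enc_prod, enc_list_ofFn]
  rfl

theorem Instance.encode_eq (F : Instance Λ) : F.encode = enc (List.range F.n, F.raw) := by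
  rw [enc_prod, Instance.raw, enc_list_ofFn, ← encodeVars_eq]
  simp only [Constraint.enc_raw]
  rfl

theorem WeightedInstance.encode_eq (F : WeightedInstance Λ) :
    F.encode = enc (List.range F.n, F.rawWeighted) := by
  rw [enc_prod, WeightedInstance.rawWeighted, enc_list_ofFn, ← encodeVars_eq]
  simp only [enc_prod, Constraint.enc_raw]
  rfl

/-- An assignment as a list of numbers. -/
def rawAssignment {n : ℕ} (χ : Fin n → Fin Λ.q) : List ℕ := List.ofFn fun i => (χ i : ℕ)

theorem enc_rawAssignment (F : Instance Λ) (χ : F.Assignment) :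
    enc (rawAssignment χ) = F.encodeAssignment χ := enc_list_ofFn _

/-- The constraints of the regularized instance. -/
def regularizeRaw (L : List RawConstraint) (M : ℕ) : List RawConstraint :=
  (List.range (M * L.length)).map fun r => ((L.getD (r % L.length) (0, [])).1,
    (L.getD (r % L.length) (0, [])).2.map (newVar L M (r / L.length) (r % L.length)))

theorem Instance.raw_regularize (F : Instance Λ) (M : ℕ) :
    (F.regularize M).raw = regularizeRaw F.raw M := by
  have hm : (F.regularize M).m = M * F.m := rfl
  refine List.ext_getElem (by simp [regularizeRaw, hm]) fun k h₁ h₂ => ?_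
  rw [length_raw, hm] at h₁
  have hk : F.raw.getD (k % F.m) (0, []) = (F.constr (Fin.modNat ⟨k, h₁⟩)).raw :=
    F.getD_raw (Fin.modNat ⟨k, h₁⟩)
  simp only [regularizeRaw, List.getElem_map, List.getElem_range, length_raw, hk]
  simp only [raw, List.getElem_ofFn, Constraint.raw, List.map_ofFn]
  rfl

/-- The list of the values of the rounded assignment. -/
def roundRaw (L : List RawConstraint) (n t : ℕ) (c : List ℕ) : List ℕ :=
  (List.range n).map fun i => c.getD (offset L i + t % deg L i) 0

/-- For indices out of range, the default 0 of `getD` agrees with the default value of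
`roundAssignment`. -/
theorem Instance.rawAssignment_roundAssignment (F : Instance Λ) (hq : 0 < Λ.q) (M t : ℕ)
    (χ : (F.regularize M).Assignment) :
    rawAssignment (F.roundAssignment hq M t χ) = roundRaw F.raw F.n t (rawAssignment χ) := by
  refine List.ext_getElem (by simp [rawAssignment, roundRaw]) fun k h₁ h₂ => ?_
  simp only [rawAssignment, roundRaw, List.getElem_ofFn, List.getElem_map, List.getElem_range,
    roundAssignment, List.getD_eq_getElem?_getD, List.getElem?_ofFn]
  split_ifs <;> simp

/-- The satisfying tuples of all predicates. -/
noncomputable def satTable (Λ : CSP) : List Data :=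
  ((Finset.univ : Finset (Σ k : Fin Λ.numPred, Fin (Λ.pred k).arity → Fin Λ.q)).filter
    fun x => (Λ.pred x.1).holds x.2 = true).toList.map fun x =>
      enc ((x.1 : ℕ), rawAssignment x.2)

theorem enc_list_nat_injective : Function.Injective (enc : List ℕ → Data) := by
  intro l
  induction l with
  | nil => intro l' h; cases l' <;> [rfl; exact absurd h (by simp [enc_nil, enc_cons])]
  | cons x l ih =>
    intro l' h
    cases l' with
    | nil => exact absurd h (by simp [enc_nil, enc_cons])
    | cons y l' =>
      simp only [enc_cons, Data.pair.injEq, enc_nat, Data.num.injEq] at h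
      rw [h.1, ih h.2]

theorem mem_satTable (k : Fin Λ.numPred) (x : Fin (Λ.pred k).arity → Fin Λ.q) :
    enc ((k : ℕ), rawAssignment x) ∈ satTable Λ ↔ (Λ.pred k).holds x = true := by
  simp only [satTable, List.mem_map, Finset.mem_toList, Finset.mem_filter, Finset.mem_univ,
    true_and]
  constructor
  · rintro ⟨⟨k', x'⟩, hx, h⟩
    simp only [enc_prod, Data.pair.injEq, enc_nat, Data.num.injEq] at h
    obtain rfl := Fin.ext h.1
    have h := List.ofFn_injective (enc_list_nat_injective h.2)
    have : x' = x := funext fun j => Fin.ext (congrFun h j)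
    exact this ▸ hx
  · exact fun h => ⟨⟨k, x⟩, h, rfl⟩

open Classical in
/-- The cost of a list of values. -/
noncomputable def costRaw (Λ : CSP) (U : List (RawConstraint × ℕ)) (c : List ℕ) : ℕ :=
  (U.map fun x => if enc (x.1.1, x.1.2.map fun i => c.getD i 0) ∈ satTable Λ then x.2 else 0).sum

theorem WeightedInstance.costRaw_eq (F : WeightedInstance Λ) (χ : F.Assignment) :
    costRaw Λ F.rawInt (rawAssignment χ) = F.cost χ := by
  classical
  have h : ∀ r, ((F.constr r).raw.2.map fun i => (rawAssignment χ).getD i 0) =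
      rawAssignment fun j => χ ((F.constr r).scope j) := by
    intro r
    refine List.ext_getElem (by simp [Constraint.raw, rawAssignment]) fun k h₁ h₂ => ?_
    simp [Constraint.raw, rawAssignment]
  rw [costRaw, rawInt_eq, List.map_ofFn, List.sum_ofFn, cost]
  refine Finset.sum_congr rfl fun r _ => ?_
  simp only [Function.comp_apply, h, Constraint.sat, mul_ite, mul_one, mul_zero]
  exact if_congr (mem_satTable (F.constr r).idx _) rfl rfl

/-- The first of several pairs with the smallest first entry. -/
def minFst (b : ℕ × List ℕ) (l : List (ℕ × List ℕ)) : ℕ × List ℕ :=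
  l.foldl (fun b x => if x.1 < b.1 then x else b) b

theorem minFst_mem (l : List (ℕ × List ℕ)) (b : ℕ × List ℕ) : minFst b l ∈ b :: l := by
  induction l generalizing b with
  | nil => exact List.mem_singleton_self b
  | cons x l ih =>
    have := ih (if x.1 < b.1 then x else b)
    change minFst (if x.1 < b.1 then x else b) l ∈ _
    split_ifs at this ⊢ <;> simp only [List.mem_cons] at this ⊢ <;> tauto

theorem minFst_le (l : List (ℕ × List ℕ)) (b : ℕ × List ℕ) :
    (minFst b l).1 ≤ b.1 ∧ ∀ x ∈ l, (minFst b l).1 ≤ x.1 := by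
  induction l generalizing b with
  | nil => exact ⟨le_rfl, by simp⟩
  | cons x l ih =>
    have h := ih (if x.1 < b.1 then x else b)
    change (minFst (if x.1 < b.1 then x else b) l).1 ≤ _ ∧
      ∀ y ∈ x :: l, (minFst (if x.1 < b.1 then x else b) l).1 ≤ _
    have h' : (if x.1 < b.1 then x else b).1 ≤ b.1 ∧ (if x.1 < b.1 then x else b).1 ≤ x.1 := by
      split_ifs <;> omega
    refine ⟨h.1.trans h'.1, fun y hy => ?_⟩
    rcases List.mem_cons.1 hy with rfl | hy
    · exact h.1.trans h'.2
    · exact h.2 y hy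

/-! ### The algorithm runs in polynomial time -/

theorem PolyBdd.var_range {ι : Type} {a : ι → Data} {n : ι → ℕ} (hb : PolyBdd a n) :
    PolyBdd (ext a fun i => List.range (n i)) fun z => z.1.2 :=
  (hb.lift _).mono fun z => (List.mem_range.1 z.2).le

namespace PolyFun

variable {ι : Type} {a : ι → Data} {L : ι → List RawConstraint} {M s t i n : ι → ℕ}

theorem occ (hL : PolyFun a L) (hs : PolyFun a s) (hbs : PolyBdd a s) (hi : PolyFun a i) :
    PolyFun a fun x => occ (L x) (s x) (i x) :=
  (hL.getD _ hs hbs).snd.count hi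

theorem rank (hL : PolyFun a L) (hs : PolyFun a s) (hbs : PolyBdd a s) (hi : PolyFun a i) :
    PolyFun a fun x => rank (L x) (s x) (i x) :=
  sum_range hs hbs ((hL.lift _).occ (var _) hbs.var_range (hi.lift _))

theorem deg (hL : PolyFun a L) (hi : PolyFun a i) : PolyFun a fun x => deg (L x) (i x) :=
  hL.rank hL.length hL.polyBdd_length hi

theorem offset (hL : PolyFun a L) (hi : PolyFun a i) (hbi : PolyBdd a i) :
    PolyFun a fun x => offset (L x) (i x) :=
  sum_range hi hbi ((hL.lift _).deg (var _))

theorem newVar (hL : PolyFun a L) (hM : PolyFun a M) (ht : PolyFun a t) (hs : PolyFun a s)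
    (hbs : PolyBdd a s) (hi : PolyFun a i) (hbi : PolyBdd a i) :
    PolyFun a fun x => newVar (L x) (M x) (t x) (s x) (i x) :=
  (hL.offset hi hbi).add (ite (.lt ht ((hL.deg hi).mul (hM.div (hL.deg hi))))
    (ht.mod (hL.deg hi)) (hL.rank hs hbs hi))

/-- Computing an offset loops over all smaller variables, so the variable numbers have to be bounded
in value; this is the role of `n`. -/
theorem regularizeRaw (hL : PolyFun a L) (hM : PolyFun a M) (hbM : PolyBdd a M)
    (hn : PolyBdd a n) (hLn : ∀ x s, ∀ i ∈ ((L x).getD s (0, [])).2, i ≤ n x) :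
    PolyFun a fun x => regularizeRaw (L x) (M x) := by
  have hb := hbM.mul hL.polyBdd_length
  have hr := var (a := a) fun x => List.range (M x * (L x).length)
  have hL' := hL.lift fun x => List.range (M x * (L x).length)
  have hM' := hM.lift fun x => List.range (M x * (L x).length)
  have hs := hr.mod hL'.length
  have hbs := hb.var_range.mono fun z => Nat.mod_le z.1.2 (L z.1.1).length
  have hC := hL'.getD (0, []) hs hbs
  refine map (range (hM.mul hL.length) hb) (hC.fst.prod (hC.snd.map (newVar (hL'.lift _)
    (hM'.lift _) ((hr.div hL'.length).lift _) (hs.lift _) (hbs.lift _) (var _) ?_)))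
  exact ((hn.lift _).lift _).mono fun z => hLn _ _ _ z.2

theorem roundRaw {c : ι → List ℕ} (hL : PolyFun a L) (hn : PolyFun a n) (hbn : PolyBdd a n)
    (ht : PolyFun a t) (hc : PolyFun a c)
    (hb : PolyBdd (ext a fun x => List.range (n x))
      fun z => RegCSP.offset (L z.1.1) z.1.2 + t z.1.1 % RegCSP.deg (L z.1.1) z.1.2) :
    PolyFun a fun x => roundRaw (L x) (n x) (t x) (c x) :=
  map (range hn hbn) (getD 0 (hc.lift _) (((hL.lift _).offset (var _) hbn.var_range).add
    ((ht.lift _).mod ((hL.lift _).deg (var _)))) hb)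

theorem costRaw {U : ι → List (RawConstraint × ℕ)} {c : ι → List ℕ} (hU : PolyFun a U)
    (hc : PolyFun a c) (hn : PolyBdd a n) (hUn : ∀ x, ∀ y ∈ U x, ∀ i ∈ y.1.2, i ≤ n x) :
    PolyFun a fun x => costRaw Λ (U x) (c x) := by
  classical
  have hx := var (a := a) U
  have hvals : PolyFun (ext a U) fun z => z.1.2.1.2.map fun i => (c z.1.1).getD i 0 :=
    map hx.fst.snd (getD 0 ((hc.lift _).lift _) (var _)
      (((hn.lift _).lift _).mono fun z => hUn _ _ z.1.1.2 _ z.2))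
  have hdec : PolyDec (ext a U) fun z =>
      enc (z.1.2.1.1, z.1.2.1.2.map fun i => (c z.1.1).getD i 0) ∈ satTable Λ :=
    PolyDec.mem_list _ (hx.fst.fst.prod hvals)
  unfold RegCSP.costRaw
  exact (hU.map (ite hdec hx.snd (nat 0))).sum

theorem minFst {b : ι → ℕ × List ℕ} {l : ι → List (ℕ × List ℕ)} (hb : PolyFun a b)
    (hl : PolyFun a l) : PolyFun a fun x => minFst (b x) (l x) :=
  foldl (f := fun _ (b x : ℕ × List ℕ) => if x.1 < b.1 then x else b) hl hb
    (ite (.lt (elem _ _).fst (acc _ _).fst) (elem _ _) (acc _ _))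
    -- The accumulator is always the start value or a list entry, so it cannot grow.
    ⟨_, hb.polyBdd_size.add hl.polyBdd_size, fun i l' h => by
      rcases List.mem_cons.1 (minFst_mem l' (b i)) with h' | h'
      · exact (congrArg (fun x => (enc x).size) h').le.trans (Nat.le_add_right _ _)
      · exact (size_enc_lt_of_mem (h.subset h')).le.trans (Nat.le_add_left _ _)⟩

end PolyFun

/-- Fixing the outputs as a function of the input makes the closure properties of `PolyTime`
applicable. -/
theorem solvableInPolyTime_iff {I : Type} {O : I → Type} {encIn : I → Data}
    {encOut : ∀ i, O i → Data} {good : ∀ i, O i → Prop} :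
    SolvableInPolyTime encIn encOut good ↔
      ∃ o : ∀ i, O i, PolyTime encIn (fun i => encOut i (o i)) ∧ ∀ i, good i (o i) := by
  constructor
  · rintro ⟨c, p, h⟩
    choose o t hr ht hg using h
    exact ⟨o, ⟨c, t, hr, p, ht⟩, hg⟩
  · rintro ⟨o, ⟨c, t, hr, p, ht⟩, hg⟩
    exact ⟨c, p, fun i => ⟨o i, t i, hr i, ht i, hg i⟩⟩

namespace WeightedInstance

theorem polyFun_range : PolyFun (fun F : WeightedInstance Λ => F.encode)
    fun F => List.range F.n := by
  have h : PolyFun (fun F : WeightedInstance Λ => F.encode)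
      fun F => (List.range F.n, F.rawWeighted) := by
    simp only [encode_eq]
    exact PolyTime.id
  exact h.fst

theorem polyFun_rawWeighted : PolyFun (fun F : WeightedInstance Λ => F.encode)
    fun F => F.rawWeighted := by
  have h : PolyFun (fun F : WeightedInstance Λ => F.encode)
      fun F => (List.range F.n, F.rawWeighted) := by
    simp only [encode_eq]
    exact PolyTime.id
  exact h.snd

theorem polyFun_n : PolyFun (fun F : WeightedInstance Λ => F.encode) fun F => F.n := by
  simpa using (polyFun_range (Λ := Λ)).length

theorem polyBdd_n : PolyBdd (fun F : WeightedInstance Λ => F.encode) fun F => F.n := by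
  simpa using (polyFun_range (Λ := Λ)).polyBdd_length

theorem polyFun_m : PolyFun (fun F : WeightedInstance Λ => F.encode) fun F => F.m := by
  simpa [rawWeighted] using (polyFun_rawWeighted (Λ := Λ)).length

theorem polyBdd_m : PolyBdd (fun F : WeightedInstance Λ => F.encode) fun F => F.m := by
  simpa [rawWeighted] using (polyFun_rawWeighted (Λ := Λ)).polyBdd_length

theorem polyFun_rawInt : PolyFun (fun F : WeightedInstance Λ => F.encode) fun F => F.rawInt := by
  have hx := PolyFun.var (a := fun F : WeightedInstance Λ => F.encode) rawWeighted
  have hD : PolyFun (fun F : WeightedInstance Λ => F.encode) fun F => F.commonDen :=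
    (polyFun_rawWeighted.map (f := fun _ x => x.2.2) hx.snd.snd).prod_list
  exact polyFun_rawWeighted.map (hx.fst.prod (hx.snd.fst.mul ((hD.lift _).div hx.snd.snd)))

theorem polyFun_guesses : PolyFun (fun F : WeightedInstance Λ => F.encode)
    fun F => F.guesses := by
  have hx := PolyFun.var (a := fun F : WeightedInstance Λ => F.encode) rawInt
  exact polyFun_rawInt.map (hx.snd.add ((PolyFun.nat 1).sub hx.snd))

/-- An instance together with a guess. -/
def encodeGuess : {z : WeightedInstance Λ × ℕ // z.2 ∈ z.1.guesses} → Data :=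
  ext (fun F => F.encode) guesses

theorem raw_scaled (F : WeightedInstance Λ) (K B w : ℕ) : (F.scaled K B w).raw =
    F.rawInt.flatMap fun x => (List.range (multiplicity K B F.m w x.2)).map fun _ => x.1 := by
  have h : (F.scaled K B w).raw = _ :=
    F.raw_expand fun r => multiplicity K B F.m w (F.intWeight r)
  rw [h, rawInt_eq, List.ofFn_eq_map, List.flatMap_map]
  simp

theorem polyFun_raw_scaled (K B : ℕ) : PolyFun (encodeGuess (Λ := Λ))
    fun z => (z.1.1.scaled K B z.1.2).raw := by
  simp only [raw_scaled]
  have hm := polyFun_m (Λ := Λ).lift guesses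
  have hbm := polyBdd_m (Λ := Λ).lift guesses
  have hw := PolyFun.var (a := fun F : WeightedInstance Λ => F.encode) guesses
  have hU := polyFun_rawInt (Λ := Λ).lift guesses
  have hx := PolyFun.var (a := encodeGuess (Λ := Λ)) fun z => z.1.1.rawInt
  refine hU.flatMap (PolyFun.map (PolyFun.range ?_ ?_) (hx.fst.lift _))
  · unfold multiplicity
    have h₁ := ((hx.snd.mul ((PolyFun.nat K).mul (hm.lift _))).add
      ((hw.lift _).sub (.nat 1))).div (hw.lift _)
    have h₂ := ((PolyFun.nat B).mul (hm.mul hm)).lift fun z => z.1.1.rawInt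
    simp only [min_def]
    exact PolyFun.ite ((PolyDec.lt h₂ h₁).not.congr fun z => not_lt) h₁ h₂
  -- Only the cap keeps the number of repetitions polynomial; the uncapped quotient can be
  -- exponential.
  · exact (((PolyBdd.const B).mul (hbm.mul hbm)).lift _).mono fun z => min_le_right _ _

theorem scope_le_of_mem_getD (F : Instance Λ) (s : ℕ) :
    ∀ i ∈ (F.raw.getD s (0, [])).2, i ≤ F.n := by
  intro i hi
  rcases lt_or_ge s F.m with h | h
  · rw [F.getD_raw ⟨s, h⟩, Constraint.raw] at hi
    obtain ⟨j, rfl⟩ := (List.mem_ofFn' _ _).1 hi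
    exact Fin.is_lt _ |>.le
  · simp [h] at hi

theorem polyFun_m_scaled (K B : ℕ) : PolyFun (encodeGuess (Λ := Λ))
    fun z => (z.1.1.scaled K B z.1.2).m := by
  simpa using (polyFun_raw_scaled (Λ := Λ) K B).length

theorem polyBdd_m_scaled (K B : ℕ) : PolyBdd (encodeGuess (Λ := Λ))
    fun z => (z.1.1.scaled K B z.1.2).m := by
  simpa using (polyFun_raw_scaled (Λ := Λ) K B).polyBdd_length

theorem polyTime_encode_regularized (K B : ℕ) : PolyTime (encodeGuess (Λ := Λ))
    fun z => (z.1.1.regularized K B z.1.2).encode := by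
  have hL := polyFun_raw_scaled (Λ := Λ) K B
  have hW := polyFun_m_scaled (Λ := Λ) K B
  have hbW := polyBdd_m_scaled (Λ := Λ) K B
  have hn := polyFun_n (Λ := Λ).lift guesses
  have hbn := polyBdd_n (Λ := Λ).lift guesses
  have hM := (PolyFun.nat K).mul hW
  have hbM := (PolyBdd.const K).mul hbW
  have hraw := hL.regularizeRaw hM hbM hbn fun z => scope_le_of_mem_getD (z.1.1.scaled K B z.1.2)
  have hN := hL.offset hn hbn
  have hbN : PolyBdd (encodeGuess (Λ := Λ))
      fun z => offset (z.1.1.scaled K B z.1.2).raw z.1.1.n := by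
    refine (hbn.mul hbW).mono fun z => ?_
    refine (Finset.sum_le_sum fun i _ => (z.1.1.scaled K B z.1.2).deg_raw_le i).trans ?_
    simp
  have := (PolyFun.range hN hbN).prod hraw
  unfold PolyFun at this
  simp only [Instance.encode_eq, regularized, Instance.raw_regularize]
  exact this

/-- The rounded solutions for all guesses. -/
def candidates (K B : ℕ) (out : WeightedInstance Λ → ℕ → List ℕ) (F : WeightedInstance Λ) :
    List (List ℕ) :=
  F.guesses.flatMap fun w => (List.range (K * (F.scaled K B w).m)).map fun t =>
    roundRaw (F.scaled K B w).raw F.n t (out F w)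

/-- The best of the rounded solutions. -/
noncomputable def bestCandidate (K B : ℕ) (out : WeightedInstance Λ → ℕ → List ℕ)
    (F : WeightedInstance Λ) : List ℕ :=
  -- The zero assignment merely provides a start value for the minimum.
  (minFst (costRaw Λ F.rawInt ((List.range F.n).map fun _ => 0), (List.range F.n).map fun _ => 0)
    ((F.candidates K B out).map fun c => (costRaw Λ F.rawInt c, c))).2

theorem polyFun_candidates (K B : ℕ) {out : WeightedInstance Λ → ℕ → List ℕ}
    (hout : PolyFun (encodeGuess (Λ := Λ)) fun z => out z.1.1 z.1.2) :
    PolyFun (fun F : WeightedInstance Λ => F.encode) fun F => F.candidates K B out := by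
  have hL := polyFun_raw_scaled (Λ := Λ) K B
  have hW := polyFun_m_scaled (Λ := Λ) K B
  have hbW := polyBdd_m_scaled (Λ := Λ) K B
  have hn := polyFun_n (Λ := Λ).lift guesses
  have hbn := polyBdd_n (Λ := Λ).lift guesses
  have hM := (PolyFun.nat K).mul hW
  have hbM := (PolyBdd.const K).mul hbW
  refine polyFun_guesses.flatMap (PolyFun.map (PolyFun.range hM hbM) ((hL.lift _).roundRaw
    (hn.lift _) (hbn.lift _) (PolyFun.var _) (hout.lift _) ?_))
  -- The offset is at most the number of variables times the number of constraints, and the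
  -- remainder is at most `t`, even for degree 0.
  refine ((((hbn.mul hbW).add hbM).lift _).lift _).mono fun z => ?_
  have h₁ := List.mem_range.1 z.1.1.2
  have h₂ := List.mem_range.1 z.2
  refine Nat.add_le_add ?_ ((Nat.mod_le _ _).trans h₁.le)
  refine (offset_mono h₂.le).trans ?_
  refine (Finset.sum_le_sum fun i _ =>
    (z.1.1.1.1.1.1.scaled K B z.1.1.1.1.1.2).deg_raw_le i).trans ?_
  simp

theorem scope_le_of_mem_rawInt (F : WeightedInstance Λ) :
    ∀ y ∈ F.rawInt, ∀ i ∈ y.1.2, i ≤ F.n := by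
  intro y hy i hi
  rw [rawInt_eq] at hy
  obtain ⟨r, rfl⟩ := (List.mem_ofFn' _ _).1 hy
  obtain ⟨j, rfl⟩ := (List.mem_ofFn' _ _).1 hi
  exact Fin.is_lt _ |>.le

theorem polyFun_bestCandidate (K B : ℕ) {out : WeightedInstance Λ → ℕ → List ℕ}
    (hout : PolyFun (encodeGuess (Λ := Λ)) fun z => out z.1.1 z.1.2) :
    PolyFun (fun F : WeightedInstance Λ => F.encode) fun F => F.bestCandidate K B out := by
  have hzero : PolyFun (fun F : WeightedInstance Λ => F.encode)
      fun F => (List.range F.n).map fun _ => 0 := polyFun_range.map (.nat 0)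
  refine (PolyFun.minFst ((polyFun_rawInt.costRaw hzero polyBdd_n scope_le_of_mem_rawInt).prod
    hzero) ((polyFun_candidates K B hout).map (.prod ?_ (PolyFun.var _)))).snd
  exact (polyFun_rawInt.lift _).costRaw (PolyFun.var _) (polyBdd_n.lift _)
    fun z => scope_le_of_mem_rawInt z.1.1

/-- The best candidate is an assignment that is at least as good as all rounded assignments. -/
theorem exists_bestCandidate (F : WeightedInstance Λ) (hq : 0 < Λ.q) (K B : ℕ)
    (out : WeightedInstance Λ → ℕ → List ℕ) (sol : ∀ w, (F.regularized K B w).Assignment)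
    (hsol : ∀ w ∈ F.guesses, out F w = rawAssignment (sol w)) :
    ∃ χ : F.Assignment, F.bestCandidate K B out = rawAssignment χ ∧
      ∀ w ∈ F.guesses, ∀ t < K * (F.scaled K B w).m,
        F.cost χ ≤ F.cost ((F.scaled K B w).roundAssignment hq _ t (sol w)) := by
  have hzero : ((List.range F.n).map fun _ => 0) =
      rawAssignment (fun _ => ⟨0, hq⟩ : F.Assignment) := by
    refine List.ext_getElem (by simp [rawAssignment]) fun k h₁ h₂ => by simp [rawAssignment]
  have hround : ∀ w ∈ F.guesses, ∀ t, roundRaw (F.scaled K B w).raw F.n t (out F w) =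
      rawAssignment ((F.scaled K B w).roundAssignment hq (K * (F.scaled K B w).m) t (sol w)) :=
    fun w hw t => by
      rw [hsol w hw]
      exact (Instance.rawAssignment_roundAssignment (F.scaled K B w) hq _ t (sol w)).symm
  have hmem : ∀ x ∈ (costRaw Λ F.rawInt ((List.range F.n).map fun _ => 0),
      (List.range F.n).map fun _ => 0) ::
      ((F.candidates K B out).map fun c => (costRaw Λ F.rawInt c, c)),
      ∃ χ : F.Assignment, x = (F.cost χ, rawAssignment χ) := by
    intro x hx
    rcases List.mem_cons.1 hx with rfl | hx
    · exact ⟨_, by rw [hzero, costRaw_eq]⟩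
    · obtain ⟨c, hc, rfl⟩ := List.mem_map.1 hx
      obtain ⟨w, hw, hc⟩ := List.mem_flatMap.1 hc
      obtain ⟨t, _, rfl⟩ := List.mem_map.1 hc
      rw [hround w hw]
      exact ⟨_, by rw [← costRaw_eq]; rfl⟩
  obtain ⟨χ, hχ⟩ := hmem _ (minFst_mem _ _)
  refine ⟨χ, congrArg Prod.snd hχ, fun w hw t ht => ?_⟩
  have hle := (minFst_le ((F.candidates K B out).map fun c => (costRaw Λ F.rawInt c, c))
    (costRaw Λ F.rawInt ((List.range F.n).map fun _ => 0), (List.range F.n).map fun _ => 0)).2 _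
    (List.mem_map.2 ⟨_, List.mem_flatMap.2 ⟨w, hw, List.mem_map.2 ⟨t, List.mem_range.2 ht, rfl⟩⟩,
      rfl⟩)
  rw [hχ, hround w hw] at hle
  rw [← costRaw_eq F ((F.scaled K B w).roundAssignment hq _ t (sol w))]
  exact hle

end WeightedInstance

/-! ### The empty alphabet and the final estimate -/

/-- If all regular instances have an assignment, then the alphabet is nonempty or there are no
variables. -/
theorem WeightedInstance.n_eq_zero_of_q_eq_zero (F : WeightedInstance Λ) (hq : Λ.q = 0)
    (h : ∀ G : Instance Λ, G.Regular → 0 < G.m → Nonempty G.Assignment) : F.n = 0 := by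
  have hn : ∀ G : Instance Λ, G.Regular → 0 < G.m → G.n = 0 := by
    intro G hG hm
    obtain ⟨χ⟩ := h G hG hm
    by_contra hn
    exact absurd (χ ⟨0, Nat.pos_of_ne_zero hn⟩).2 (by omega)
  obtain ⟨r, _⟩ := F.exists_intWeight_pos
  rcases Nat.eq_zero_or_pos (Λ.pred (F.constr r).idx).arity with hk | hk
  -- A single constraint of arity 0 makes an instance on all `F.n` variables that is regular of
  -- degree 0.
  · refine hn ⟨F.n, 1, fun _ => F.constr r⟩ ⟨0, fun i => ?_⟩ one_pos
    rw [Instance.degree]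
    have : IsEmpty {_s : Fin 1 // ∃ j, (F.constr r).scope j = i} :=
      ⟨fun s => by obtain ⟨j, _⟩ := s.2; exact absurd j.2 (by omega)⟩
    exact Nat.card_of_isEmpty
  -- A positive arity is impossible: one constraint on exactly its own variables is regular of
  -- degree 1.
  · have := hn ⟨(Λ.pred (F.constr r).idx).arity, 1,
      fun _ => ⟨(F.constr r).idx, Function.Embedding.refl _⟩⟩ ⟨1, fun i => ?_⟩ one_pos
    · exact absurd this hk.ne'
    · rw [Instance.degree, Nat.card_eq_one_iff_unique]
      exact ⟨⟨fun x y => Subtype.ext (Subsingleton.elim _ _)⟩, ⟨⟨0, i, rfl⟩⟩⟩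

/-- An approximation algorithm for unweighted regular instances yields one for weighted instances,
with an arbitrarily small loss in the factor. -/
theorem HasRegularMinApprox.hasWeightedMinApprox {α δ : ℝ} (hα : 1 ≤ α) (hδ : 0 < δ)
    (h : HasRegularMinApprox Λ α) : HasWeightedMinApprox Λ (α + δ) := by
  obtain ⟨o, ho, hgood⟩ := solvableInPolyTime_iff.1 h
  refine solvableInPolyTime_iff.2 ?_
  rcases Nat.eq_zero_or_pos Λ.q with hq | hq
  -- Without variables there is just one assignment, encoded as `0`; it is optimal, and `α + δ ≥ 1`.
  · have hn : ∀ F : WeightedInstance Λ, F.n = 0 := fun F =>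
      F.n_eq_zero_of_q_eq_zero hq fun G hG hm => ⟨o ⟨G, hG, hm⟩⟩
    have hempty : ∀ F : WeightedInstance Λ, IsEmpty (Fin F.n) := fun F => by
      rw [hn F]; infer_instance
    refine ⟨fun F => (hempty F).elim, ?_, fun F => ?_⟩
    · convert PolyTime.num (a := fun F : WeightedInstance Λ => F.encode) 0 using 2 with F
      rw [← enc_rawAssignment, List.eq_nil_of_length_eq_zero (l := rawAssignment _)
        (by simp [rawAssignment, hn F])]
      rfl
    · have := hempty F
      refine F.val_le_mul_opt _ fun ψ => ?_
      rw [Subsingleton.elim ψ fun i => (hempty F).elim i]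
      exact le_mul_of_one_le_left (Nat.cast_nonneg _) (by linarith)
  -- The estimate `α * (K + 1) ≤ (K - 1) * (α + δ)` amounts to `2 * α ≤ δ * (K - 1)`; the summand 2
  -- also ensures `K ≥ 2`.
  · obtain ⟨K, hK⟩ := exists_nat_ge (2 + 2 * α / δ)
    obtain ⟨B, hB⟩ := exists_nat_gt (α * (K * (K + 1)))
    have hpos : 0 < 2 * α / δ := by positivity
    have hK2 : 2 ≤ K := by
      have : (2 : ℝ) ≤ K := by linarith
      exact_mod_cast this
    have hBpos : 0 < B := by
      have : (0 : ℝ) < B := lt_of_le_of_lt (by positivity) hB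
      exact_mod_cast this
    have hfactor : α * (K + 1) ≤ ((K : ℝ) - 1) * (α + δ) := by
      have : 2 * α / δ ≤ (K : ℝ) - 1 := by linarith
      rw [div_le_iff₀ hδ] at this
      nlinarith
    let reg : ∀ (F : WeightedInstance Λ) (w : ℕ), 1 ≤ w →
        {G : Instance Λ // G.Regular ∧ 0 < G.m} := fun F w hw =>
      ⟨F.regularized K B w, F.regular_regularized K B w,
        F.regularized_m_pos (by omega) hBpos hw⟩
    let sol : ∀ (F : WeightedInstance Λ) (w : ℕ), (F.regularized K B w).Assignment := fun F w =>
      -- The default covers only `w = 0`, which is never a guess.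
      if hw : 1 ≤ w then o (reg F w hw) else fun _ => ⟨0, hq⟩
    have hsol : ∀ F w (hw : 1 ≤ w), sol F w = o (reg F w hw) := fun F w hw => dif_pos hw
    have hout : PolyFun (WeightedInstance.encodeGuess (Λ := Λ))
        fun z => rawAssignment (sol z.1.1 z.1.2) := by
      have h₁ := (ho.reindex fun z : {z : WeightedInstance Λ × ℕ // z.2 ∈ z.1.guesses} =>
        reg z.1.1 z.1.2 (z.1.1.one_le_of_mem_guesses z.2)).comp
        (WeightedInstance.polyTime_encode_regularized K B)
      unfold PolyFun
      convert h₁ using 2 with z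
      exact (congrArg (fun χ => Enc.enc (rawAssignment χ))
        (hsol _ _ (z.1.1.one_le_of_mem_guesses z.2))).trans (enc_rawAssignment _ _)
    choose χ hχ hbest using fun F : WeightedInstance Λ => F.exists_bestCandidate hq K B
      (fun F w => rawAssignment (sol F w)) (sol F) fun _ _ => rfl
    refine ⟨χ, ?_, fun F => F.val_le_mul_opt _ fun ψ => ?_⟩
    · have heq : (fun F : WeightedInstance Λ => F.encodeAssignment (χ F)) = fun F =>
          Enc.enc (F.bestCandidate K B fun F w => rawAssignment (sol F w)) := funext fun F => by
        rw [hχ F]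
        exact (enc_rawAssignment F.toInstance (χ F)).symm
      rw [heq]
      exact WeightedInstance.polyFun_bestCandidate K B hout
    · obtain ⟨w, hw, t, ht, hcost⟩ := F.exists_round_cost_le (by linarith) hK2 hB hBpos hq (sol F)
        (fun w hw => by
          rw [hsol F w hw]
          exact hgood (reg F w hw)) ψ
      have h₁ : (F.cost (χ F) : ℝ) ≤
          F.cost ((F.scaled K B w).roundAssignment hq _ t (sol F w)) := by
        exact_mod_cast hbest F w hw t ht
      have hK1 : (0 : ℝ) < K - 1 := by linarith
      refine le_of_mul_le_mul_left ?_ hK1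
      calc ((K : ℝ) - 1) * F.cost (χ F)
          ≤ (K - 1) * F.cost ((F.scaled K B w).roundAssignment hq _ t (sol F w)) :=
            mul_le_mul_of_nonneg_left h₁ hK1.le
        _ ≤ α * (K + 1) * F.cost ψ := hcost
        _ ≤ (K - 1) * (α + δ) * F.cost ψ :=
            mul_le_mul_of_nonneg_right hfactor (Nat.cast_nonneg _)
        _ = (K - 1) * ((α + δ) * F.cost ψ) := by ring

end RegCSP

theorem theorem2 (Λ : RegCSP.CSP) (α : ℝ) (hα : 1 ≤ α)
    (h : RegCSP.HasRegularMinApprox Λ α) :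
    ∀ δ : ℝ, 0 < δ → RegCSP.HasWeightedMinApprox Λ (α + δ) := by
  intro δ hδ
  exact h.hasWeightedMinApprox hα hδ
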